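/- Let $\Bbbk$ be an algebraically closed field of characteristic $0$, let $V$ be a finite-dimensional $\Bbbk$-vector space, and let $(\mathfrak g,G)$ be one of $(\mathfrak{sl}(V),SL(V))$, $(\mathfrak{so}(V,\Phi),SO(V,\Phi))$, $(\mathfrak{sp}(V,\Phi),Sp(V,\Phi))$, where in the last two cases $\Phi$ is a nondegenerate bilinear form on $V$, symmetric, respectively alternating. Fix a Cartan subalgebra $\mathfrak t$ of $\mathfrak g$ and a system $\Pi$ of simple roots that is a basis of $\mathfrak t^*$ (so the abelian algebra $\mathfrak{so}_2$ is excluded). *Definitions.* Elements $e,h,f\in\mathfrak g$ form a triple if $[e,f]=h$, $[h,e]=2e$, $[h,f]=-2f$ (the zero triple is allowed); then $h$ is called a characteristic of $e$. The weighted Dynkin diagram $\mathcal D(e)$ of a nilpotent $e$ with characteristic $h$ is the family $(\alpha(h_+))_{\alpha\in\Pi}$, where $h_+$ is the element of $G\cdot h\cap\mathfrak t$ with $\alpha(h_+)\ge 0$ for all $\alpha\in\Pi$; the marks are natural numbers. A pair of nilpotent orbits $(\mathcal O,\mathcal O^{\langle2\rangle})=(G\cdot e,G\cdot e')$ is *friendly*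 if $\mathcal D(e')=\tfrac12\mathcal D(e)$. For a friendly pair, $e\in\mathcal O$ and a triple $(e,h,f)$, write $e^{\langle2\rangle}$ for an element of $\mathcal O^{\langle2\rangle}$ such that $[h,e^{\langle2\rangle}]=4e^{\langle2\rangle}$ and $h/2$ is a characteristic of $e^{\langle2\rangle}$. The pair is *very friendly* if, for all such $e$ and $(e,h,f)$, the element $e^{\langle2\rangle}$ can be chosen such that $[e,e^{\langle2\rangle}]=0$. **Lemma.** Every friendly pair $(\mathcal O,\mathcal O^{\langle2\rangle})$ in $\mathfrak g$ is very friendly. Moreover, for every $e\in\mathcal O$ and every triple $(e,h,f)$ in $\mathfrak g$, the following construction of an element $x\in\mathfrak g$ from the Jordan normal form of $e$ can be carried out, and, however it is carried out, $x$ can be taken as $e^{\langle2\rangle}$ and $[e,x]=0$. By a Jordan block of size $r$ we mean here a subspace with a basis $u,eu,\dots,e^{r-1}u$ such that $e^ru=0$ and $hu=-(r-1)u$. * $\mathfrak g=\mathfrak{sl}(V)$: $x=e^2$, the square of $e$ as an endomorphism of $V$. * $\mathfrak g=\mathfrak{sp}(V)$: write $V$ as a direct sum of pairwise $\Phi$-orthogonal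 subspaces of type (a) below, and let $x$ be as described on each of them. * $\mathfrak g=\mathfrak{so}(V)$: the same with subspaces of types (a), (b), (c). (a) $A\oplus B$, where $A,B$ are $\Phi$-isotropic Jordan blocks of the same odd size; $x|_A=e^2|_A$ and $x|_B=-e^2|_B$. (b) For some $m\ge1$, a subspace with basis $v_1,\dots,v_{4m+1},w_2,\dots,w_{4m}$ such that, with $v_i=0$ for $i>4m+1$ and $w_i=0$ for $i>4m$, one has $e v_i=v_{i+1}$, $e w_i=w_{i+1}$, $hv_1=-4m\,v_1$, $hw_2=-(4m-2)w_2$, $\Phi(v_i,v_{4m+2-j})=(-1)^{i-1}\delta_{ij}$, $\Phi(w_i,w_{4m+2-j})=(-1)^i\delta_{ij}$, $\Phi(v_i,w_j)=0$; and $x v_i=-w_{i+2}$, $x w_i=-v_{i+2}$. (c) A subspace on which $e$ and $h$ vanish; $x$ is $0$ on it. -/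

import Mathlib

attribute [local instance 100] LieRing.ofAssociativeRing

namespace FriendlyPairs

universe u v w

section LieAlgebras

variable {𝕜 : Type u} [Field 𝕜] {L : Type v} [LieRing L] [LieAlgebra 𝕜 L]

/-- The relations `[e,f] = h`, `[h,e] = 2e`, `[h,f] = -2f`. Thus `h` is a characteristic of `e`.
The zero triple is admitted, so that `0` is a characteristic of the nilpotent element `0`. -/
structure IsTriple (e h f : L) : Prop where
  lie_e_f : ⁅e, f⁆ = h
  lie_h_e : ⁅h, e⁆ = 2 • e
  lie_h_f : ⁅h, f⁆ = -(2 • f)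

/-- `h` is a characteristic of `e`. -/
def IsCharacteristic (h e : L) : Prop := ∃ f : L, IsTriple e h f

/-- `α` is a root of `L` with respect to the subalgebra `H`. -/
def IsRoot (H : LieSubalgebra 𝕜 L) (α : Module.Dual 𝕜 H) : Prop :=
  α ≠ 0 ∧ ∃ x : L, x ≠ 0 ∧ ∀ t : H, ⁅(t : L), x⁆ = α t • x

/-- `Δ` is a system of simple roots of `L` with respect to `H`: a basis of the dual of `H`, made of
roots, such that the coordinates of each root are all in `ℕ` or all in `-ℕ`. -/
structure IsSimpleRoots {ι : Type w} (H : LieSubalgebra 𝕜 L)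
    (Δ : Module.Basis ι 𝕜 (Module.Dual 𝕜 H)) : Prop where
  isRoot : ∀ i, IsRoot H (Δ i)
  coord : ∀ β, IsRoot H β →
    (∀ i, ∃ n : ℕ, Δ.repr β i = (n : 𝕜)) ∨ (∀ i, ∃ n : ℕ, Δ.repr β i = -(n : 𝕜))

end LieAlgebras

section Groups

variable {𝕜 : Type u} [Field 𝕜] {V : Type v} [AddCommGroup V] [Module 𝕜 V]

/-- The special linear Lie algebra: endomorphisms of trace zero. -/
noncomputable def slLie (𝕜 : Type u) [Field 𝕜] (V : Type v) [AddCommGroup V] [Module 𝕜 V] :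
    LieSubalgebra 𝕜 (Module.End 𝕜 V) :=
  { LinearMap.ker (LinearMap.trace 𝕜 V) with
    lie_mem' := fun {x y} _ _ => LinearMap.mem_ker.2 (LinearMap.trace_lie x y) }

/-- The special linear group: automorphisms of determinant one. -/
noncomputable def slGroup (𝕜 : Type u) [Field 𝕜] (V : Type v) [AddCommGroup V] [Module 𝕜 V] :
    Subgroup (V ≃ₗ[𝕜] V) :=
  (LinearEquiv.det : (V ≃ₗ[𝕜] V) →* 𝕜ˣ).ker

/-- The group of all automorphisms preserving the bilinear form `Φ`. It is the symplectic group when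
`Φ` is alternating and the full orthogonal group when `Φ` is symmetric (`Φ` nondegenerate). The Lie
algebra that goes with it is Mathlib's `skewAdjointLieSubalgebra Φ`. -/
def isometryGroup (Φ : LinearMap.BilinForm 𝕜 V) : Subgroup (V ≃ₗ[𝕜] V) where
  carrier := {a | ∀ u v, Φ (a u) (a v) = Φ u v}
  one_mem' := fun _ _ => rfl
  mul_mem' := by
    intro a b ha hb u v
    have h1 := ha (b u) (b v)
    rw [hb u v] at h1
    exact h1
  inv_mem' := by
    intro a ha u v
    have h1 := ha (a⁻¹ u) (a⁻¹ v)
    have h2 : ∀ x, a (a⁻¹ x) = x := fun x => a.apply_symm_apply x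
    rw [h2, h2] at h1
    exact h1.symm

variable {g : LieSubalgebra 𝕜 (Module.End 𝕜 V)}

/-- The orbit `G · x` in the linear Lie algebra `g`, where `G` acts by conjugation. -/
def orbit (G : Subgroup (V ≃ₗ[𝕜] V)) (x : g) : Set g :=
  {y | ∃ a ∈ G, (y : Module.End 𝕜 V) = a.conj (x : Module.End 𝕜 V)}

/-- `d` is the weighted Dynkin diagram of `e`: for some characteristic `h` of `e`, the orbit `G · h`
contains an element `h₊` of the Cartan subalgebra `H` on which each simple root `Δ i` takes the value
`d i`. As the marks are natural numbers, `h₊` is dominant. -/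
def HasDiagram {ι : Type w} (G : Subgroup (V ≃ₗ[𝕜] V)) {H : LieSubalgebra 𝕜 g}
    (Δ : Module.Basis ι 𝕜 (Module.Dual 𝕜 H)) (e : g) (d : ι → ℕ) : Prop :=
  ∃ h : g, IsCharacteristic h e ∧ ∃ hplus : H, (hplus : g) ∈ orbit G h ∧
    ∀ i, Δ i hplus = (d i : 𝕜)

/-- `O` is a divisible orbit, with diagram `2d`, and `O'` is the orbit with the halved diagram
`d`. -/
def IsFriendlyPair {ι : Type w} (G : Subgroup (V ≃ₗ[𝕜] V)) {H : LieSubalgebra 𝕜 g}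
    (Δ : Module.Basis ι 𝕜 (Module.Dual 𝕜 H)) (O O' : Set g) : Prop :=
  ∃ (d : ι → ℕ) (e e' : g), HasDiagram G Δ e (fun i => 2 * d i) ∧ HasDiagram G Δ e' d ∧
    O = orbit G e ∧ O' = orbit G e'

/-- The requirement on an element `e^⟨2⟩`, given the orbit `O' = O^⟨2⟩` and a characteristic `h` of
an element of `O`: it lies in `O'` and in `g(4)`, and `h / 2` is a characteristic of it. -/
structure IsHalfElement (h : g) (O' : Set g) (x : g) : Prop where
  mem_orbit : x ∈ O'
  lie_h : ⁅h, x⁆ = 4 • x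
  isCharacteristic : IsCharacteristic ((2⁻¹ : 𝕜) • h) x

/-- A friendly pair is very friendly if, for each `e` in `O` with a triple `e, h, f`, the element
`e^⟨2⟩` can be chosen to commute with `e`. -/
def IsVeryFriendlyPair {ι : Type w} (G : Subgroup (V ≃ₗ[𝕜] V)) {H : LieSubalgebra 𝕜 g}
    (Δ : Module.Basis ι 𝕜 (Module.Dual 𝕜 H)) (O O' : Set g) : Prop :=
  IsFriendlyPair G Δ O O' ∧
    ∀ e ∈ O, ∀ h f : g, IsTriple e h f → ∃ x : g, IsHalfElement h O' x ∧ ⁅e, x⁆ = 0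

end Groups

section Constructions

variable {𝕜 : Type u} [Field 𝕜] {V : Type v} [AddCommGroup V] [Module 𝕜 V]

/-- `A` is a Jordan block of `e` of size `r`, with basis `u, e u, …, e^(r-1) u`, stable under the
characteristic `h`, whose eigenvalues on it are `-(r-1), -(r-3), …, r-1`. -/
def IsJordanBlock (e h : Module.End 𝕜 V) (r : ℕ) (A : Submodule 𝕜 V) : Prop :=
  ∃ u : V, LinearIndependent 𝕜 (fun i : Fin r => (e ^ (i : ℕ)) u) ∧
    Submodule.span 𝕜 (Set.range fun i : Fin r => (e ^ (i : ℕ)) u) = A ∧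
    (e ^ r) u = 0 ∧ h u = (1 - (r : 𝕜)) • u

/-- `U` is the direct sum of two isotropic Jordan blocks of `e` of the same odd size, and `x` acts as
`e²` on the first and as `-e²` on the second. -/
def IsEqualPiece (Φ : LinearMap.BilinForm 𝕜 V) (e h x : Module.End 𝕜 V)
    (U : Submodule 𝕜 V) : Prop :=
  ∃ (l : ℕ) (A B : Submodule 𝕜 V),
    IsJordanBlock e h (2 * l + 1) A ∧ IsJordanBlock e h (2 * l + 1) B ∧
    Disjoint A B ∧ A ⊔ B = U ∧
    (∀ a ∈ A, ∀ b ∈ A, Φ a b = 0) ∧ (∀ a ∈ B, ∀ b ∈ B, Φ a b = 0) ∧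
    (∀ a ∈ A, x a = e (e a)) ∧ (∀ b ∈ B, x b = -e (e b))

/-- `U` is the orthogonal sum of two Jordan blocks of `e`, of sizes `4m + 1` and `4m - 1`, with bases
`v 1, …, v (4m+1)` and `w 2, …, w (4m)` normalised with respect to `e` and `Φ`, and `x` interchanges
the two blocks: `x (v i) = -w (i+2)` and `x (w i) = -v (i+2)`. Vectors with an index beyond the last
one are zero. -/
def IsMixedPiece (Φ : LinearMap.BilinForm 𝕜 V) (e h x : Module.End 𝕜 V)
    (U : Submodule 𝕜 V) : Prop :=
  ∃ (m : ℕ) (v w : ℕ → V), 1 ≤ m ∧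
    LinearIndependent 𝕜 (Sum.elim (fun i : Set.Icc 1 (4 * m + 1) => v i)
      (fun i : Set.Icc 2 (4 * m) => w i)) ∧
    Submodule.span 𝕜 (v '' Set.Icc 1 (4 * m + 1) ∪ w '' Set.Icc 2 (4 * m)) = U ∧
    (∀ i, 4 * m + 1 < i → v i = 0) ∧ (∀ i, 4 * m < i → w i = 0) ∧
    (∀ i, 1 ≤ i → e (v i) = v (i + 1)) ∧ (∀ i, 2 ≤ i → e (w i) = w (i + 1)) ∧
    h (v 1) = (-(4 * m : 𝕜)) • v 1 ∧ h (w 2) = (2 - (4 * m : 𝕜)) • w 2 ∧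
    (∀ i ∈ Set.Icc 1 (4 * m + 1), ∀ j ∈ Set.Icc 1 (4 * m + 1),
      Φ (v i) (v j) = if i + j = 4 * m + 2 then (-1) ^ (i + 1) else 0) ∧
    (∀ i ∈ Set.Icc 2 (4 * m), ∀ j ∈ Set.Icc 2 (4 * m),
      Φ (w i) (w j) = if i + j = 4 * m + 2 then (-1) ^ i else 0) ∧
    (∀ i ∈ Set.Icc 1 (4 * m + 1), ∀ j ∈ Set.Icc 2 (4 * m), Φ (v i) (w j) = 0) ∧
    (∀ i, 1 ≤ i → x (v i) = -w (i + 2)) ∧ (∀ i, 2 ≤ i → x (w i) = -v (i + 2))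

/-- `U` is a sum of Jordan blocks of size one, on which the triple of `e` acts by zero, and so does
`x`. -/
def IsTrivialPiece (e h x : Module.End 𝕜 V) (U : Submodule 𝕜 V) : Prop :=
  ∀ u ∈ U, e u = 0 ∧ h u = 0 ∧ x u = 0

/-- `V` is a direct sum of finitely many pairwise `Φ`-orthogonal subspaces with the property `P`. -/
def IsOrthogonalSum (Φ : LinearMap.BilinForm 𝕜 V) (P : Submodule 𝕜 V → Prop) : Prop :=
  ∃ (k : ℕ) (U : Fin k → Submodule 𝕜 V), DirectSum.IsInternal U ∧
    (∀ i j, i ≠ j → ∀ a ∈ U i, ∀ b ∈ U j, Φ a b = 0) ∧ ∀ j, P (U j)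

/-- The construction of `x = e^⟨2⟩` in the special linear case: `x` is the matrix square of `e`. -/
def SlConstruction (e x : Module.End 𝕜 V) : Prop := x = e ^ 2

/-- The construction of `x = e^⟨2⟩` in the symplectic case, from the Jordan form of `e`. -/
def SpConstruction (Φ : LinearMap.BilinForm 𝕜 V) (e h x : Module.End 𝕜 V) : Prop :=
  IsOrthogonalSum Φ (IsEqualPiece Φ e h x)

/-- The construction of `x = e^⟨2⟩` in the orthogonal case, from the Jordan form of `e`. -/
def SoConstruction (Φ : LinearMap.BilinForm 𝕜 V) (e h x : Module.End 𝕜 V) : Prop :=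
  IsOrthogonalSum Φ fun U =>
    IsEqualPiece Φ e h x U ∨ IsMixedPiece Φ e h x U ∨ IsTrivialPiece e h x U

end Constructions

end FriendlyPairs

/-! The argument replaces a triple by the pair `(e, h)` with the hard Lefschetz property
(`IsLefschetz`): `h` is diagonalisable with integral weights, `e` raises weights by two, and `e ^ k`
maps weight `-k` bijectively onto weight `k`. Every triple gives such a pair
(`IsTriple.isLefschetz`), and every such pair has a basis of Jordan strings over its primitive
vectors (`prim`). The numbers of strings of each length can be read off from the kernels of powers
of `e`, or from the weight multiplicities of `h`. They determine the pair up to `GL(V)`. Rescaling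
brings the conjugator into `SL(V)`. When `e` and `h` are skew for a form, the form induces on each
space of primitive vectors a nondegenerate form that is symmetric or alternating; its normal form
yields conjugacy under isometries. A reflection along a string of odd length corrects the
determinant in the special orthogonal case.

For a friendly pair, the equality of diagrams up to a factor two and the conjugacy of
characteristics show that `h / 2` is a characteristic of an element of `O'` (`HasConj.exists_half`).
Hence any `x` in `g` for which `(x, h / 2)` is a Lefschetz pair has the same string numbers as that
element, so it lies in `O'` and is half of a triple (`HasConj.isHalfElement`). It remains to see
that `x`, however constructed, commutes with `e` and is Lefschetz for `h / 2`. For forms this is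
checked on each summand (`SoConstruction.good_eq_top`); for `sl` it is immediate for `e ^ 2`.

Existence of the decomposition is a matter of parity. All weights of `h` are even, so only strings
of odd length occur. In the symplectic case each length occurs an even number of times, and strings
pair up. In the orthogonal case the unpaired strings are matched between lengths `4m + 1` and `4m -
1`: the two multiplicities add up to that of a string of even length `2m` for the element of `O'`,
and the latter multiplicity is even (`exists_soConstruction`). -/

namespace FriendlyPairs

universe u v w

set_option linter.unusedSectionVars false

/-! ### Weights, and the Lefschetz property of a triple -/

section Lefschetz

variable {𝕜 : Type u} [Field 𝕜] {V : Type v} [AddCommGroup V] [Module 𝕜 V]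

/-- The eigenspace of `h` for the integral eigenvalue `k`. -/
noncomputable def wt (h : Module.End 𝕜 V) (k : ℤ) : Submodule 𝕜 V :=
  Module.End.eigenspace h (k : 𝕜)

theorem mem_wt {h : Module.End 𝕜 V} {k : ℤ} {v : V} : v ∈ wt h k ↔ h v = (k : 𝕜) • v :=
  Module.End.mem_eigenspace_iff

/-- `e` raises weights of `h` by two, `h` is diagonalisable with integral weights, and each power
`e ^ k` is a bijection from weight `-k` to weight `k`. -/
structure IsLefschetz (e h : Module.End 𝕜 V) : Prop where
  comm : ∀ v, h (e v) = e (h v) + (2 : 𝕜) • e v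
  span : ⨆ k : ℤ, wt h k = ⊤
  inj : ∀ k : ℕ, ∀ v ∈ wt h (-k), (e ^ k) v = 0 → v = 0
  surj : ∀ k : ℕ, ∀ v ∈ wt h k, ∃ u ∈ wt h (-k), (e ^ k) u = v

theorem pow_mem_wt {e h : Module.End 𝕜 V} (he : ∀ v, h (e v) = e (h v) + (2 : 𝕜) • e v)
    {j : ℤ} {v : V} (hv : v ∈ wt h j) (i : ℕ) : (e ^ i) v ∈ wt h (j + 2 * i) := by
  induction i with
  | zero => simpa using hv
  | succ i ih =>
    rw [mem_wt] at ih ⊢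
    rw [pow_succ', Module.End.mul_apply, he, ih]
    push_cast
    rw [map_smul]
    module

theorem mem_wt_add_two {e h : Module.End 𝕜 V} (he : ∀ v, h (e v) = e (h v) + (2 : 𝕜) • e v)
    {j : ℤ} {v : V} (hv : v ∈ wt h j) : e v ∈ wt h (j + 2) := by
  simpa using pow_mem_wt he hv 1

variable [CharZero 𝕜]

theorem iSupIndep_wt (h : Module.End 𝕜 V) : iSupIndep (wt h) :=
  (Module.End.eigenspaces_iSupIndep h).comp Int.cast_injective

/-- The powers `e ^ n` are eigenvectors of `ad h` with the distinct eigenvalues `2 n`; if none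
vanished, they would form an infinite independent family in the finite-dimensional space `End V`. -/
theorem isNilpotent_of_raising [FiniteDimensional 𝕜 V] {e h : Module.End 𝕜 V}
    (he : ∀ v, h (e v) = e (h v) + (2 : 𝕜) • e v) : ∃ n : ℕ, e ^ n = 0 := by
  by_contra! hne
  have key : ∀ n : ℕ, h * e ^ n = e ^ n * h + (2 * n : 𝕜) • e ^ n := by
    intro n
    induction n with
    | zero => simp
    | succ n ih =>
      have h1 : h * e = e * h + (2 : 𝕜) • e := LinearMap.ext he
      rw [pow_succ, ← mul_assoc, ih, add_mul, mul_assoc, h1, mul_add, mul_smul_comm, smul_mul_assoc]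
      rw [← mul_assoc]
      push_cast
      module
  have hli := Module.End.eigenvectors_linearIndependent'
    (LinearMap.mulLeft 𝕜 h - LinearMap.mulRight 𝕜 h) (fun n : ℕ => (2 * n : 𝕜))
    (fun a b hab => by simpa using hab) (fun n => e ^ n) (fun n => by
      refine ⟨?_, hne n⟩
      rw [Module.End.mem_eigenspace_iff]
      simp [key n])
  have := hli.finite
  exact not_finite ℕ

namespace IsTriple

variable {e h f : Module.End 𝕜 V}

theorem apply_e_f (t : IsTriple e h f) (v : V) : e (f v) = f (e v) + h v := by
  have := LinearMap.congr_fun t.lie_e_f v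
  simp only [Ring.lie_def, LinearMap.sub_apply, Module.End.mul_apply] at this
  rw [← this]; abel

theorem apply_h_e (t : IsTriple e h f) (v : V) : h (e v) = e (h v) + (2 : 𝕜) • e v := by
  have := LinearMap.congr_fun t.lie_h_e v
  simp only [Ring.lie_def, LinearMap.sub_apply, Module.End.mul_apply, LinearMap.smul_apply] at this
  rw [ofNat_smul_eq_nsmul, ← this]; abel

theorem symm (t : IsTriple e h f) : IsTriple f (-h) e := by
  refine ⟨?_, ?_, ?_⟩
  · rw [← t.lie_e_f, lie_skew]
  · rw [neg_lie, t.lie_h_f, neg_neg]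
  · rw [neg_lie, t.lie_h_e]

theorem apply_h_f (t : IsTriple e h f) (v : V) : h (f v) = f (h v) - (2 : 𝕜) • f v := by
  have := t.symm.apply_h_e v
  simp only [LinearMap.neg_apply, map_neg] at this
  rw [neg_eq_iff_eq_neg.1 this]; module

/-- This is `[e ^ (k + 1), f] = (k + 1) e ^ k (h + k)`, the source of every nonzero scalar in the
representation theory below. -/
theorem e_pow_f (t : IsTriple e h f) (k : ℕ) (v : V) : (e ^ (k + 1)) (f v) =
    f ((e ^ (k + 1)) v) + (k + 1 : 𝕜) • (e ^ k) (h v) + ((k + 1) * k : 𝕜) • (e ^ k) v := by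
  induction k generalizing v with
  | zero => simp [t.apply_e_f]
  | succ k ih =>
    rw [pow_succ, Module.End.mul_apply, t.apply_e_f, map_add, ih (e v), t.apply_h_e]
    simp only [pow_succ, Module.End.mul_apply, map_add, map_smul]
    push_cast
    module

/-- On a lowest vector of weight `-m`, `f e ^ (j + 1) v` is `(j + 1) (m - j) e ^ j v`, and the
scalar is nonzero for `j < m`. So vanishing descends from `e ^ (j + 1) v` to `e ^ j v`. -/
theorem eq_zero_of_e_pow (t : IsTriple e h f) {m : ℕ} {v : V} (hf : f v = 0)
    (hv : h v = -(m : 𝕜) • v) (j : ℕ) (hj : j ≤ m) (h0 : (e ^ j) v = 0) : v = 0 := by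
  induction j with
  | zero => simpa using h0
  | succ j ih =>
    apply ih (by omega)
    have := t.e_pow_f j v
    rw [hf, h0, hv] at this
    simp only [map_zero, map_smul, zero_add, smul_smul, ← add_smul] at this
    have h2 := smul_eq_zero.1 this.symm
    refine h2.resolve_left fun h3 => ?_
    have h4 : ((j + 1 : ℕ) : 𝕜) * ((m - j : ℕ) : 𝕜) = 0 := by
      rw [Nat.cast_sub (by omega)]; push_cast; linear_combination -h3
    rw [← Nat.cast_mul, Nat.cast_eq_zero] at h4
    rcases Nat.mul_eq_zero.1 h4 with h | h <;> omega

/-- Induction on the power of `f` that kills `v`: the vector `f v` has weight `-(k + 2)` and is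
killed by `e ^ (k + 2)`, so it vanishes, which makes `v` a lowest vector. -/
theorem inj_aux (t : IsTriple e h f) (j : ℕ) : ∀ (k : ℕ) (v : V), h v = -(k : 𝕜) • v →
    (f ^ j) v = 0 → (e ^ k) v = 0 → v = 0 := by
  induction j with
  | zero => intro k v _ h0 _; simpa using h0
  | succ j ih =>
    intro k v hv hf he
    have hfv : f v = 0 := by
      refine ih (k + 2) (f v) ?_ (by simpa [pow_succ] using hf) ?_
      · rw [t.apply_h_f, hv]; push_cast; rw [map_smul]; module
      · rw [t.e_pow_f, hv, pow_succ', pow_succ', Module.End.mul_apply, Module.End.mul_apply]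
        simp [he]
    exact t.eq_zero_of_e_pow hfv hv k le_rfl he

/-- If `f v = 0` and `e ^ (n + 1) v = 0`, the commutation formula gives `e ^ n (h + n) v = 0`, so
induction applies to `(h + n) v`. As `h + n` is invertible on the weights `0, …, -(n - 1)`,
subtracting a suitable `w` from `v` leaves a vector of weight `-n`. -/
theorem ker_f_mem (t : IsTriple e h f) (n : ℕ) : ∀ v, f v = 0 → (e ^ n) v = 0 →
    v ∈ ⨆ i : Fin n, wt h (-(i : ℕ)) ⊓ LinearMap.ker f := by
  induction n with
  | zero => intro v _ h0; simp at h0; simp [h0]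
  | succ n ih =>
    intro v hf h0
    have h1 : f (h v) = 0 := by
      have := t.apply_h_f v
      rw [hf] at this; simpa using this.symm
    have h2 := ih (h v + (n : 𝕜) • v) (by simp [h1, hf]) (by
      have := t.e_pow_f n v
      rw [hf, h0, map_zero, map_zero, zero_add, mul_smul, ← smul_add] at this
      rw [map_add, map_smul]
      exact (smul_eq_zero.1 this.symm).resolve_left (Nat.cast_add_one_ne_zero n))
    have key : ∀ z ∈ ⨆ i : Fin n, wt h (-(i : ℕ)) ⊓ LinearMap.ker f,
        ∃ w ∈ ⨆ i : Fin n, wt h (-(i : ℕ)) ⊓ LinearMap.ker f, h w + (n : 𝕜) • w = z := by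
      intro z hz
      induction hz using Submodule.iSup_induction' with
      | mem i x hx =>
        refine ⟨((n : 𝕜) - (i : ℕ))⁻¹ • x, Submodule.smul_mem _ _ (Submodule.mem_iSup_of_mem i hx), ?_⟩
        have hne : (n : 𝕜) - (i : ℕ) ≠ 0 := sub_ne_zero.2 (by exact_mod_cast i.2.ne')
        have := mem_wt.1 hx.1
        rw [map_smul, this]
        push_cast
        rw [smul_smul, smul_smul, ← add_smul, mul_comm, ← add_mul, neg_add_eq_sub, mul_inv_cancel₀ hne,
          one_smul]
      | zero => exact ⟨0, Submodule.zero_mem _, by simp⟩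
      | add x y _ _ hx hy =>
        obtain ⟨a, ha, rfl⟩ := hx
        obtain ⟨b, hb, rfl⟩ := hy
        exact ⟨a + b, Submodule.add_mem _ ha hb, by rw [map_add]; module⟩
    obtain ⟨w, hw, hwv⟩ := key _ h2
    have hwf : f w = 0 := by
      have : (⨆ i : Fin n, wt h (-(i : ℕ)) ⊓ LinearMap.ker f) ≤ LinearMap.ker f :=
        iSup_le fun i => inf_le_right
      exact this hw
    have hle : (⨆ i : Fin n, wt h (-(i : ℕ)) ⊓ LinearMap.ker f) ≤
        ⨆ i : Fin (n + 1), wt h (-(i : ℕ)) ⊓ LinearMap.ker f :=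
      iSup_le fun i => le_iSup (fun i : Fin (n + 1) => wt h (-(i : ℕ)) ⊓ LinearMap.ker f) i.castSucc
    have hvw : v - w ∈ wt h (-(n : ℕ)) ⊓ LinearMap.ker f := by
      refine ⟨mem_wt.2 ?_, by simp [hf, hwf]⟩
      rw [map_sub, ← sub_eq_zero]
      push_cast
      linear_combination (norm := module) -hwv
    rw [← sub_add_cancel v w]
    exact Submodule.add_mem _
      (le_iSup (fun i : Fin (n + 1) => wt h (-(i : ℕ)) ⊓ LinearMap.ker f) (Fin.last n) hvw) (hle hw)

variable [FiniteDimensional 𝕜 V]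

theorem ker_f_le (t : IsTriple e h f) :
    LinearMap.ker f ≤ ⨆ i : ℕ, wt h (-i) ⊓ LinearMap.ker f := by
  intro v hv
  obtain ⟨n, hn⟩ := isNilpotent_of_raising t.apply_h_e
  have := t.ker_f_mem n v hv (by simp [hn])
  exact (iSup_le fun i : Fin n => le_iSup (fun i : ℕ => wt h (-i) ⊓ LinearMap.ker f) (i : ℕ)) this

/-- The eigenvalues of `h` on `ker f` are nonpositive, so `h - (n + 1)` is invertible there. -/
theorem exists_shift_ker_f (t : IsTriple e h f) (n : ℕ) {z : V} (hz : f z = 0) :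
    ∃ w, f w = 0 ∧ h w - (n + 1 : 𝕜) • w = z := by
  have hz' := t.ker_f_le (show z ∈ LinearMap.ker f from hz)
  clear hz
  induction hz' using Submodule.iSup_induction' with
  | mem i x hx =>
    have hne : (n : 𝕜) + 1 + i ≠ 0 := by exact_mod_cast (by omega : n + 1 + i ≠ 0)
    have hf : f x = 0 := hx.2
    refine ⟨-((n : 𝕜) + 1 + i)⁻¹ • x, by simp [hf], ?_⟩
    have := mem_wt.1 hx.1
    rw [map_smul, this]
    push_cast
    rw [← one_smul 𝕜 x]
    simp only [smul_smul, ← sub_smul]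
    congr 1
    field_simp
    ring
  | zero => exact ⟨0, by simp⟩
  | add x y _ _ hx hy =>
    obtain ⟨a, ha, rfl⟩ := hx
    obtain ⟨b, hb, rfl⟩ := hy
    exact ⟨a + b, by simp [ha, hb], by rw [map_add]; module⟩

/-- The preimage `v` is corrected by an element of `ker e` to have weight `-(n + 2)`. Then `f e v' =
0`, and the formula for the reversed triple, whose scalars are positive integers, descends from `f ^
(j + 1) v' = 0` to `f ^ j v' = 0`. -/
theorem ker_f_inf_range_e_aux (t : IsTriple e h f) {n : ℕ} {x v : V} (hx : h x = -(n : 𝕜) • x)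
    (hf : f x = 0) (hv : e v = x) : x = 0 := by
  have hz : e (h v + (n + 2 : 𝕜) • v) = 0 := by
    have := t.apply_h_e v
    rw [hv, hx] at this
    rw [map_add, map_smul, hv]
    linear_combination (norm := module) -this
  obtain ⟨w, hw, hw2⟩ := t.symm.exists_shift_ker_f (n + 1) hz
  set v' := v + w with hv'
  have hev : e v' = x := by simp [hv', hv, hw]
  have hhv : h v' = -(n + 2 : 𝕜) • v' := by
    rw [hv', map_add]
    simp only [LinearMap.neg_apply] at hw2
    push_cast at hw2
    linear_combination (norm := module) -hw2
  obtain ⟨N, hN⟩ := isNilpotent_of_raising t.symm.apply_h_e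
  have key : ∀ j : ℕ, (f ^ j) v' = 0 → v' = 0 := by
    intro j
    induction j with
    | zero => intro h0; simpa using h0
    | succ j ih =>
      intro h0
      apply ih
      have := t.symm.e_pow_f j v'
      rw [hev, h0, LinearMap.neg_apply, hhv, pow_succ, Module.End.mul_apply, hf] at this
      simp only [map_zero, map_smul, zero_add, neg_smul, neg_neg, smul_smul,
        ← add_smul] at this
      refine (smul_eq_zero.1 this.symm).resolve_left ?_
      have : ((j : 𝕜) + 1) * (n + 2) + (j + 1) * j = (((j + 1) * (n + 2) + (j + 1) * j : ℕ) : 𝕜) := by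
        push_cast; ring
      rw [this, ← ne_eq, Nat.cast_ne_zero]
      positivity
  have := key N (by simp [hN])
  rw [← hev, this, map_zero]

theorem ker_f_inf_range_e (t : IsTriple e h f) : LinearMap.ker f ⊓ LinearMap.range e = ⊥ := by
  rw [eq_bot_iff]
  rintro x ⟨hf, v, hv⟩
  obtain ⟨n, hn⟩ := isNilpotent_of_raising t.apply_h_e
  have hx := t.ker_f_mem n x hf (by simp [hn])
  clear hn
  simp only [Submodule.mem_bot]
  induction n generalizing x v with
  | zero => rwa [iSup_of_empty, Submodule.mem_bot] at hx
  | succ n ih =>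
    have hle : ∀ y ∈ ⨆ i : Fin (n + 1), wt h (-(i : ℕ)) ⊓ LinearMap.ker f,
        h y + (n : 𝕜) • y ∈ ⨆ i : Fin n, wt h (-(i : ℕ)) ⊓ LinearMap.ker f := by
      intro y hy
      induction hy using Submodule.iSup_induction' with
      | mem i y hy =>
        have h1 := mem_wt.1 hy.1
        rw [h1]
        push_cast
        rw [← add_smul]
        refine Fin.lastCases (motive := fun i => y ∈ wt h (-((i : ℕ) : ℤ)) ⊓ LinearMap.ker f →
          (-((i : ℕ) : 𝕜) + n) • y ∈ _) ?_ ?_ i hy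
        · intro _; simp
        · intro i hy
          exact Submodule.smul_mem _ _ (Submodule.mem_iSup_of_mem i (by simpa using hy))
      | zero => simp
      | add y z _ _ hy hz =>
        rw [map_add, smul_add, add_add_add_comm]
        exact Submodule.add_mem _ hy hz
    have hfx : f x = 0 := hf
    -- Applying `h + n` to `x` and `h + n + 2` to `v` preserves `e v = x` and removes the weight
    -- `-n`; by induction the result is zero, so `x` has the single weight `-n`.
    have h1 := ih (x := h x + (n : 𝕜) • x)
      (by
        have := t.apply_h_f x
        rw [hfx] at this
        simpa [hfx] using this.symm) (h v + (n + 2 : 𝕜) • v)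
      (by rw [← hv, t.apply_h_e, map_add, map_smul]; module) (hle x hx)
    exact t.ker_f_inf_range_e_aux (n := n) (by linear_combination (norm := module) h1) hfx hv

/-- Both `ker f ∩ im e` and `ker e ∩ im f` vanish, while the four dimensions add up to `2 dim V` by
rank-nullity; hence both sums fill `V`. -/
theorem ker_f_sup_range_e (t : IsTriple e h f) : LinearMap.ker f ⊔ LinearMap.range e = ⊤ := by
  have h1 := Submodule.finrank_sup_add_finrank_inf_eq (LinearMap.ker f) (LinearMap.range e)
  have h2 := Submodule.finrank_sup_add_finrank_inf_eq (LinearMap.ker e) (LinearMap.range f)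
  rw [t.ker_f_inf_range_e, finrank_bot] at h1
  rw [t.symm.ker_f_inf_range_e, finrank_bot] at h2
  have h3 := LinearMap.finrank_range_add_finrank_ker e
  have h4 := LinearMap.finrank_range_add_finrank_ker f
  have h5 := Submodule.finrank_le (LinearMap.ker e ⊔ LinearMap.range f)
  have h6 := Submodule.finrank_le (LinearMap.ker f ⊔ LinearMap.range e)
  exact Submodule.eq_top_of_finrank_eq (by omega)

/-- Iterating `V = ker f + e V` writes `V` as the sum of the spaces `e ^ i (ker f)` for `i < n` and
of `e ^ n V`, which is zero for large `n`; each `e ^ i (ker f)` is spanned by weight vectors. -/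
theorem iSup_wt (t : IsTriple e h f) : ⨆ k : ℤ, wt h k = ⊤ := by
  obtain ⟨N, hN⟩ := isNilpotent_of_raising t.apply_h_e
  have hE : ∀ x ∈ ⨆ k : ℤ, wt h k, e x ∈ ⨆ k : ℤ, wt h k := by
    intro x hx
    induction hx using Submodule.iSup_induction' with
    | mem i x hx => exact Submodule.mem_iSup_of_mem (i + 2) (mem_wt_add_two t.apply_h_e hx)
    | zero => simp
    | add x y _ _ hx hy => rw [map_add]; exact Submodule.add_mem _ hx hy
  have key : ∀ n : ℕ, ∀ v, ∃ a ∈ ⨆ k : ℤ, wt h k, ∃ b, v = a + (e ^ n) b := by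
    intro n
    induction n with
    | zero => intro v; exact ⟨0, Submodule.zero_mem _, v, by simp⟩
    | succ n ih =>
      intro v
      have hv : v ∈ LinearMap.ker f ⊔ LinearMap.range e := by
        rw [t.ker_f_sup_range_e]; trivial
      obtain ⟨y, hy, z, ⟨z, rfl⟩, rfl⟩ := Submodule.mem_sup.1 hv
      obtain ⟨a, ha, b, rfl⟩ := ih z
      refine ⟨y + e a, Submodule.add_mem _ ?_ (hE _ ha), b, ?_⟩
      · exact (iSup_le fun i : ℕ => inf_le_left.trans (le_iSup (wt h) (-(i : ℤ)))) (t.ker_f_le hy)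
      · rw [pow_succ', Module.End.mul_apply, map_add]; abel
  rw [eq_top_iff]
  intro v _
  obtain ⟨a, ha, b, rfl⟩ := key N v
  simpa [hN] using ha

theorem inj (t : IsTriple e h f) (k : ℕ) (v : V) (hv : v ∈ wt h (-k)) (h0 : (e ^ k) v = 0) :
    v = 0 := by
  obtain ⟨N, hN⟩ := isNilpotent_of_raising t.symm.apply_h_e
  exact t.inj_aux N k v (by simpa using mem_wt.1 hv) (by simp [hN]) h0

end IsTriple

theorem wt_neg (h : Module.End 𝕜 V) (k : ℤ) : wt (-h) k = wt h (-k) := by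
  ext v
  rw [mem_wt, mem_wt, LinearMap.neg_apply, neg_eq_iff_eq_neg]
  push_cast
  rw [neg_smul]

/-- Injectivity of `e ^ k` on weight spaces gives surjectivity if dimensions match. -/
theorem surj_of_inj [FiniteDimensional 𝕜 V] {e h : Module.End 𝕜 V}
    (he : ∀ v, h (e v) = e (h v) + (2 : 𝕜) • e v) (k : ℕ)
    (hd : Module.finrank 𝕜 (wt h k) ≤ Module.finrank 𝕜 (wt h (-k)))
    (hinj : ∀ v ∈ wt h (-k), (e ^ k) v = 0 → v = 0) :
    ∀ v ∈ wt h k, ∃ u ∈ wt h (-k), (e ^ k) u = v := by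
  have hmap : (wt h (-k)).map (e ^ k) ≤ wt h k := by
    rintro _ ⟨v, hv, rfl⟩
    have := pow_mem_wt he hv k
    rwa [show -(k : ℤ) + 2 * k = k by ring] at this
  have hle : Module.finrank 𝕜 (wt h (-k)) ≤ Module.finrank 𝕜 ((wt h (-k)).map (e ^ k)) := by
    have h1 : Function.Injective ((e ^ k).domRestrict (wt h (-k))) := by
      rw [← LinearMap.ker_eq_bot, LinearMap.ker_eq_bot']
      rintro ⟨v, hv⟩ h0
      exact Subtype.ext (hinj v hv h0)
    have h2 := LinearMap.finrank_range_of_inj h1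
    rw [LinearMap.range_domRestrict] at h2
    exact h2.ge
  have := Submodule.eq_of_le_of_finrank_le hmap (hd.trans hle)
  intro v hv
  rw [← this] at hv
  exact hv

theorem inj_of_surj [FiniteDimensional 𝕜 V] {e h : Module.End 𝕜 V} (k : ℕ)
    (hd : Module.finrank 𝕜 (wt h (-k)) ≤ Module.finrank 𝕜 (wt h k))
    (hs : ∀ v ∈ wt h k, ∃ u ∈ wt h (-k), (e ^ k) u = v) :
    ∀ v ∈ wt h (-k), (e ^ k) v = 0 → v = 0 := by
  have hle : wt h k ≤ (wt h (-k)).map (e ^ k) := hs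
  have h1 := LinearMap.finrank_range_add_finrank_ker ((e ^ k).domRestrict (wt h (-k)))
  rw [LinearMap.range_domRestrict] at h1
  have h2 := Submodule.finrank_mono hle
  have h3 : Module.finrank 𝕜 (LinearMap.ker ((e ^ k).domRestrict (wt h (-k)))) = 0 := by omega
  rw [Submodule.finrank_eq_zero, LinearMap.ker_eq_bot'] at h3
  intro v hv h0
  exact congrArg Subtype.val (h3 ⟨v, hv⟩ h0)

theorem finrank_wt_le_of_inj [FiniteDimensional 𝕜 V] {e h : Module.End 𝕜 V}
    (he : ∀ v, h (e v) = e (h v) + (2 : 𝕜) • e v) (k : ℕ)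
    (hinj : ∀ v ∈ wt h (-k), (e ^ k) v = 0 → v = 0) :
    Module.finrank 𝕜 (wt h (-k)) ≤ Module.finrank 𝕜 (wt h k) := by
  have hmap : (wt h (-k)).map (e ^ k) ≤ wt h k := by
    rintro _ ⟨v, hv, rfl⟩
    have := pow_mem_wt he hv k
    rwa [show -(k : ℤ) + 2 * k = k by ring] at this
  have h1 : Function.Injective ((e ^ k).domRestrict (wt h (-k))) := by
    rw [← LinearMap.ker_eq_bot, LinearMap.ker_eq_bot']
    rintro ⟨v, hv⟩ h0
    exact Subtype.ext (hinj v hv h0)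
  have h2 := LinearMap.finrank_range_of_inj h1
  rw [LinearMap.range_domRestrict] at h2
  rw [← h2]
  exact Submodule.finrank_mono hmap

theorem IsTriple.isLefschetz [FiniteDimensional 𝕜 V] {e h f : Module.End 𝕜 V}
    (t : IsTriple e h f) : IsLefschetz e h where
  comm := t.apply_h_e
  span := t.iSup_wt
  inj := t.inj
  -- Injectivity for the reversed triple `(f, -h, e)` bounds the dimension of weight `k` by that of
  -- weight `-k`.
  surj k := surj_of_inj t.apply_h_e k (by
    have := finrank_wt_le_of_inj t.symm.apply_h_e k (t.symm.inj k)
    rwa [wt_neg, wt_neg, neg_neg] at this) (t.inj k)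

end Lefschetz

/-! ### Primitive vectors and bases of Jordan strings -/

section Strings

variable {𝕜 : Type u} [Field 𝕜] [CharZero 𝕜] {V : Type v} [AddCommGroup V] [Module 𝕜 V]

/-- The primitive vectors of weight `-k`: the lowest vectors of the Jordan blocks of size `k + 1`. -/
noncomputable def prim (e h : Module.End 𝕜 V) (k : ℕ) : Submodule 𝕜 V :=
  wt h (-k) ⊓ LinearMap.ker (e ^ (k + 1))

theorem mem_prim {e h : Module.End 𝕜 V} {k : ℕ} {v : V} :
    v ∈ prim e h k ↔ v ∈ wt h (-k) ∧ (e ^ (k + 1)) v = 0 := Iff.rfl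

theorem mem_wt_of_eq {h : Module.End 𝕜 V} {i j : ℤ} {v : V} (hv : v ∈ wt h i) (hij : i = j) :
    v ∈ wt h j := hij ▸ hv

theorem LinearIndependent.eq_zero_of_injOn {J X : Type*} {T : J → V} (hT : LinearIndependent 𝕜 T)
    (π : X → J) (s : Finset X) (hπ : Set.InjOn π s) (g : X → 𝕜)
    (hs : ∑ x ∈ s, g x • T (π x) = 0) : ∀ x ∈ s, g x = 0 := by
  have hli : LinearIndepOn 𝕜 (fun x => T (π x)) (s : Set X) :=
    hT.comp (fun x : (s : Set X) => π x) (fun x y hxy => Subtype.ext (hπ x.2 y.2 hxy))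
  exact linearIndepOn_finset_iff.1 hli g hs

namespace IsLefschetz

variable {e h : Module.End 𝕜 V} (L : IsLefschetz e h)

include L

theorem pow_mem {j : ℤ} {v : V} (hv : v ∈ wt h j) (i : ℕ) : (e ^ i) v ∈ wt h (j + 2 * i) :=
  pow_mem_wt L.comm hv i

/-- The vector `e ^ (k + 1) v` has weight `k + 2`, so it equals `e ^ (k + 2) w` for some `w` of
weight `-(k + 2)`; then `v - e w` is primitive. -/
theorem exists_prim_add (k : ℕ) {v : V} (hv : v ∈ wt h (-k)) :
    ∃ p ∈ prim e h k, ∃ w ∈ wt h (-(k + 2 : ℕ)), v = p + e w := by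
  have h1 : (e ^ (k + 1)) v ∈ wt h ((k + 2 : ℕ) : ℤ) := by
    exact mem_wt_of_eq (L.pow_mem hv (k + 1)) (by push_cast; ring)
  obtain ⟨w, hw, hwv⟩ := L.surj (k + 2) _ h1
  refine ⟨v - e w, ⟨Submodule.sub_mem _ hv ?_, ?_⟩, w, hw, by abel⟩
  · exact mem_wt_of_eq (mem_wt_add_two L.comm hw) (by push_cast; ring)
  · change (e ^ (k + 1)) (v - e w) = 0
    rw [map_sub, ← hwv, pow_succ _ (k + 1), Module.End.mul_apply, sub_self]

theorem eq_zero_of_prim (k : ℕ) {w : V} (hw : w ∈ wt h (-(k + 2 : ℕ))) (hp : e w ∈ prim e h k) :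
    w = 0 :=
  L.inj (k + 2) w hw (by
    rw [pow_succ _ (k + 1), Module.End.mul_apply]
    exact hp.2)

/-- Since the decomposition of weight `-k` into primitive vectors and the injective image of weight
`-(k + 2)` is direct, the string numbers depend on `h` alone. -/
theorem finrank_prim [FiniteDimensional 𝕜 V] (k : ℕ) :
    Module.finrank 𝕜 (prim e h k) + Module.finrank 𝕜 (wt h (-(k + 2 : ℕ))) =
      Module.finrank 𝕜 (wt h (-k)) := by
  have hinj : Function.Injective (e.domRestrict (wt h (-(k + 2 : ℕ)))) := by
    rw [← LinearMap.ker_eq_bot, LinearMap.ker_eq_bot']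
    rintro ⟨w, hw⟩ h0
    refine Subtype.ext (L.eq_zero_of_prim k hw ?_)
    have : e w = 0 := h0
    rw [this]; exact Submodule.zero_mem _
  have h2 := LinearMap.finrank_range_of_inj hinj
  rw [LinearMap.range_domRestrict] at h2
  rw [← h2]
  have hinf : prim e h k ⊓ (wt h (-(k + 2 : ℕ))).map e = ⊥ := by
    rw [eq_bot_iff]
    rintro _ ⟨hp, w, hw, rfl⟩
    rw [L.eq_zero_of_prim k hw hp]; simp
  have hsup : prim e h k ⊔ (wt h (-(k + 2 : ℕ))).map e = wt h (-k) := by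
    apply le_antisymm
    · refine sup_le inf_le_left ?_
      rintro _ ⟨w, hw, rfl⟩
      exact mem_wt_of_eq (mem_wt_add_two L.comm hw) (by push_cast; ring)
    · intro v hv
      obtain ⟨p, hp, w, hw, rfl⟩ := L.exists_prim_add k hv
      exact Submodule.add_mem_sup hp ⟨w, hw, rfl⟩
  have := Submodule.finrank_sup_add_finrank_inf_eq (prim e h k) ((wt h (-(k + 2 : ℕ))).map e)
  rw [hinf, hsup, finrank_bot] at this
  omega

section Basis

variable {I : ℕ → Type w} (b : ∀ k, Module.Basis (I k) 𝕜 (prim e h k))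

/-- The map `e ^ k` is injective on weight `-k`, and tops of strings of different lengths have
different weights. -/
theorem linearIndependent_top :
    LinearIndependent 𝕜 fun x : Σ k, I k => (e ^ x.1) (b x.1 x.2 : V) := by
  have hle : ∀ k : ℕ, Submodule.span 𝕜 (Set.range fun p : I k => (e ^ k) (b k p : V)) ≤ wt h k := by
    intro k
    rw [Submodule.span_le]
    rintro _ ⟨p, rfl⟩
    have := L.pow_mem (b k p).2.1 k
    rwa [show -(k : ℤ) + 2 * k = k by ring] at this
  refine linearIndependent_iUnion_finite (f := fun k p => (e ^ k) (b k p : V)) ?_ ?_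
  · intro k
    have h1 : LinearIndependent 𝕜 fun p => (b k p : V) :=
      (b k).linearIndependent.map' (Submodule.subtype _) (Submodule.ker_subtype _)
    refine h1.map (f := e ^ k) ?_
    rw [Submodule.disjoint_def]
    intro x hx h0
    refine L.inj k x ?_ h0
    refine Submodule.span_le.2 ?_ hx
    rintro _ ⟨p, rfl⟩
    exact (b k p).2.1
  · intro k t _ hk
    refine Disjoint.mono (hle k) (iSup₂_mono fun j _ => hle j) ?_
    have := (iSupIndep_wt h).comp Nat.cast_injective k
    refine this.mono_right (iSup₂_le fun j hj => ?_)
    exact le_iSup₂_of_le (f := fun (j : ℕ) (_ : j ≠ k) => (wt h ∘ Nat.cast) j) j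
      (fun hjk => hk (hjk ▸ hj)) le_rfl

/-- In a nontrivial relation let `n` be the greatest distance to the top of its string among the
vectors that occur. Applying `e ^ n` kills all terms at smaller distance and turns the rest into
tops of strings, which are independent. -/
theorem linearIndependent_strings :
    LinearIndependent 𝕜 fun x : Σ k, I k × Fin (k + 1) => (e ^ (x.2.2 : ℕ)) (b x.1 x.2.1 : V) := by
  classical
  rw [linearIndependent_iff']
  intro s g hs
  by_contra! hne
  obtain ⟨x0, hx0, hg0⟩ := hne
  obtain ⟨y, hy, hmax⟩ := (s.filter fun x => g x ≠ 0).exists_max_image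
    (fun x => x.1 - (x.2.2 : ℕ)) ⟨x0, by simp [hx0, hg0]⟩
  rw [Finset.mem_filter] at hy
  set n := y.1 - (y.2.2 : ℕ) with hn
  have h1 := congrArg (e ^ n) hs
  rw [map_sum, map_zero, ← Finset.sum_filter_of_ne (p := fun x => x.1 - (x.2.2 : ℕ) = n)] at h1
  · refine hy.2 (LinearIndependent.eq_zero_of_injOn (L.linearIndependent_top b)
      (fun x : Σ k, I k × Fin (k + 1) => (⟨x.1, x.2.1⟩ : Σ k, I k))
      (s.filter fun x => x.1 - (x.2.2 : ℕ) = n) ?_ g ?_ y (by rw [Finset.mem_filter]; exact ⟨hy.1, rfl⟩))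
    · rintro ⟨k, p, i⟩ hx ⟨l, q, j⟩ hy hxy
      rw [Finset.mem_coe, Finset.mem_filter] at hx hy
      have hkl := congrArg Sigma.fst hxy
      simp only at hkl
      subst hkl
      have hpq := eq_of_heq (Sigma.mk.inj hxy).2
      have hij : i = j := by
        have h1 := hx.2
        have h2 := hy.2
        simp only at h1 h2
        ext; omega
      subst hij
      simp only at hpq
      rw [hpq]
    · rw [← h1]
      refine Finset.sum_congr rfl ?_
      rintro ⟨k, p, i⟩ hx
      rw [Finset.mem_filter] at hx
      have h2 := hx.2
      simp only at h2 ⊢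
      rw [map_smul, ← Module.End.mul_apply, ← pow_add, show n + (i : ℕ) = k by omega]
  · rintro ⟨k, p, i⟩ hx hne
    simp only at hne ⊢
    have hg : g ⟨k, p, i⟩ ≠ 0 := fun h0 => hne (by rw [h0, zero_smul, map_zero])
    have h2 := hmax ⟨k, p, i⟩ (by simp [hx, hg])
    simp only at h2
    by_contra hlt
    apply hne
    have hz : (e ^ (n + (i : ℕ))) (b k p : V) = 0 := by
      obtain ⟨c, hc⟩ : ∃ c, n + (i : ℕ) = c + (k + 1) := ⟨n + i - (k + 1), by omega⟩
      rw [hc, pow_add, Module.End.mul_apply, (b k p).2.2, map_zero]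
    rw [map_smul, ← Module.End.mul_apply, ← pow_add, hz, smul_zero]

/-- The span is stable under `e`. Iterating the primitive decomposition, with `e` nilpotent, puts
all nonpositive weights in it, and `e ^ n` carries weight `-n` onto weight `n`. -/
theorem span_strings [FiniteDimensional 𝕜 V] : ⊤ ≤ Submodule.span 𝕜 (Set.range
    fun x : Σ k, I k × Fin (k + 1) => (e ^ (x.2.2 : ℕ)) (b x.1 x.2.1 : V)) := by
  set S := Submodule.span 𝕜 (Set.range
    fun x : Σ k, I k × Fin (k + 1) => (e ^ (x.2.2 : ℕ)) (b x.1 x.2.1 : V)) with hS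
  have hstab : ∀ v ∈ S, e v ∈ S := by
    intro v hv
    induction hv using Submodule.span_induction with
    | mem x hx =>
      obtain ⟨⟨k, p, i⟩, rfl⟩ := hx
      simp only
      rw [← Module.End.mul_apply, ← pow_succ']
      by_cases hi : (i : ℕ) + 1 < k + 1
      · exact Submodule.subset_span ⟨⟨k, p, ⟨i + 1, hi⟩⟩, rfl⟩
      · rw [show (i : ℕ) + 1 = k + 1 by omega, (b k p).2.2]
        exact Submodule.zero_mem _
    | zero => simp
    | add x y _ _ hx hy => rw [map_add]; exact Submodule.add_mem _ hx hy
    | smul a x _ hx => rw [map_smul]; exact Submodule.smul_mem _ _ hx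
  have hpow : ∀ i : ℕ, ∀ v ∈ S, (e ^ i) v ∈ S := by
    intro i
    induction i with
    | zero => intro v hv; simpa using hv
    | succ i ih => intro v hv; rw [pow_succ, Module.End.mul_apply]; exact ih _ (hstab v hv)
  have hprim : ∀ k, prim e h k ≤ S := by
    intro k v hv
    have h1 := (b k).mem_span ⟨v, hv⟩
    have h2 := Submodule.mem_map_of_mem (f := (prim e h k).subtype) h1
    rw [Submodule.map_span] at h2
    refine Submodule.span_mono ?_ h2
    rintro _ ⟨_, ⟨p, rfl⟩, rfl⟩
    exact ⟨⟨k, p, 0⟩, by simp⟩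
  have hneg : ∀ n k : ℕ, ∀ v ∈ wt h (-k), ∃ s ∈ S, ∃ c, v = s + (e ^ n) c := by
    intro n
    induction n with
    | zero => intro k v _; exact ⟨0, Submodule.zero_mem _, v, by simp⟩
    | succ n ih =>
      intro k v hv
      obtain ⟨p, hp, w, hw, rfl⟩ := L.exists_prim_add k hv
      obtain ⟨s, hs, c, rfl⟩ := ih _ w hw
      refine ⟨p + e s, Submodule.add_mem _ (hprim k hp) (hstab s hs), c, ?_⟩
      rw [map_add, pow_succ', Module.End.mul_apply, add_assoc]
  obtain ⟨N, hN⟩ := isNilpotent_of_raising L.comm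
  have hneg' : ∀ k : ℕ, wt h (-k) ≤ S := by
    intro k v hv
    obtain ⟨s, hs, c, rfl⟩ := hneg N k v hv
    simpa [hN] using hs
  rw [← L.span]
  refine iSup_le fun k => ?_
  obtain ⟨n, rfl | rfl⟩ := k.eq_nat_or_neg
  · intro v hv
    obtain ⟨u, hu, rfl⟩ := L.surj n v hv
    exact hpow n u (hneg' n hu)
  · exact hneg' n

/-- The basis of `V` made of the Jordan strings `u, e u, …, e ^ k u` of a basis of the primitive
vectors `u` of each weight `-k`. -/
noncomputable def stringBasis [FiniteDimensional 𝕜 V] :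
    Module.Basis (Σ k, I k × Fin (k + 1)) 𝕜 V :=
  Module.Basis.mk (L.linearIndependent_strings b) (L.span_strings b)

theorem stringBasis_apply [FiniteDimensional 𝕜 V] (k : ℕ) (p : I k) (i : Fin (k + 1)) :
    L.stringBasis b ⟨k, p, i⟩ = (e ^ (i : ℕ)) (b k p : V) := by
  simp [stringBasis]

theorem e_stringBasis [FiniteDimensional 𝕜 V] (k : ℕ) (p : I k) (i : Fin (k + 1)) :
    e (L.stringBasis b ⟨k, p, i⟩) =
      if hi : (i : ℕ) + 1 < k + 1 then L.stringBasis b ⟨k, p, ⟨i + 1, hi⟩⟩ else 0 := by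
  rw [stringBasis_apply, ← Module.End.mul_apply, ← pow_succ']
  split_ifs with hi
  · rw [stringBasis_apply]
  · rw [show (i : ℕ) + 1 = k + 1 by omega, (b k p).2.2]

theorem stringBasis_mem_wt [FiniteDimensional 𝕜 V] (k : ℕ) (p : I k) (i : Fin (k + 1)) :
    L.stringBasis b ⟨k, p, i⟩ ∈ wt h (-k + 2 * (i : ℕ)) := by
  rw [stringBasis_apply]
  exact L.pow_mem (b k p).2.1 _

end Basis

/-- A subspace stable under `h` is spanned by its weight vectors. -/
theorem le_iSup_inf [FiniteDimensional 𝕜 V] {W : Submodule 𝕜 V} (hW : ∀ v ∈ W, h v ∈ W) :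
    W ≤ ⨆ j : ℤ, W ⊓ wt h j := by
  have hle : (⨆ j : ℤ, wt h j) ≤ ⨆ μ : 𝕜, h.genEigenspace μ 1 :=
    iSup_le fun j => le_iSup (fun μ : 𝕜 => h.genEigenspace μ 1) (j : 𝕜)
  have htop : (⨆ μ : 𝕜, h.genEigenspace μ 1) = ⊤ := by
    rw [L.span] at hle
    exact top_le_iff.1 hle
  have h1 := Submodule.inf_iSup_genEigenspace hW 1
  rw [htop, inf_top_eq] at h1
  conv_lhs => rw [h1]
  refine iSup_le fun μ => ?_
  by_cases hμ : ∃ j : ℤ, (j : 𝕜) = μ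
  · obtain ⟨j, rfl⟩ := hμ
    exact le_iSup (fun j : ℤ => W ⊓ wt h j) j
  · have h2 := Module.End.eigenspaces_iSupIndep h μ
    have h3 : (⊤ : Submodule 𝕜 V) ≤ ⨆ (ν : 𝕜) (_ : ν ≠ μ), h.eigenspace ν := by
      rw [← L.span]
      exact iSup_le fun j => le_iSup₂_of_le (f := fun (ν : 𝕜) (_ : ν ≠ μ) => h.eigenspace ν) (j : 𝕜)
        (fun hj => hμ ⟨j, hj⟩) le_rfl
    have h4 : h.genEigenspace μ 1 = ⊥ := by
      have := h2.mono_right h3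
      rwa [disjoint_top] at this
    rw [h4, inf_bot_eq]
    exact bot_le

/-- `e ^ m` maps weight `a` onto weight `a + 2 m` when the midpoint `a + m` is nonnegative. -/
theorem exists_pow_eq {a : ℤ} {m : ℕ} (ham : 0 ≤ a + m) {v : V} (hv : v ∈ wt h (a + 2 * m)) :
    ∃ w ∈ wt h a, (e ^ m) w = v := by
  obtain ⟨n, hn⟩ := Int.eq_ofNat_of_zero_le ham
  obtain ⟨u, hu, rfl⟩ := L.surj (n + m) v (mem_wt_of_eq hv (by push_cast; omega))
  refine ⟨(e ^ n) u, mem_wt_of_eq (L.pow_mem hu n) (by push_cast; omega), ?_⟩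
  rw [← Module.End.mul_apply, ← pow_add, add_comm]

/-- The dimension of the space of primitive vectors is determined by `e` alone. -/
theorem finrank_prim_add [FiniteDimensional 𝕜 V] (k : ℕ) :
    Module.finrank 𝕜 (prim e h k) + Module.finrank 𝕜
      (LinearMap.ker (e ^ k) ⊔ (LinearMap.ker (e ^ (k + 2))).map e : Submodule 𝕜 V) =
      Module.finrank 𝕜 (LinearMap.ker (e ^ (k + 1))) := by
  have hstab : ∀ i : ℕ, ∀ v ∈ LinearMap.ker (e ^ i), h v ∈ LinearMap.ker (e ^ i) := by
    intro i v hv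
    have key : ∀ i : ℕ, ∀ v, (e ^ i) (h v) = h ((e ^ i) v) - (2 * i : 𝕜) • (e ^ i) v := by
      intro i
      induction i with
      | zero => simp
      | succ i ih =>
        intro v
        rw [pow_succ', Module.End.mul_apply, ih, Module.End.mul_apply, map_sub, L.comm, map_smul]
        push_cast
        module
    rw [LinearMap.mem_ker] at hv ⊢
    rw [key, hv]; simp
  have hsup : prim e h k ⊔ (LinearMap.ker (e ^ k) ⊔ (LinearMap.ker (e ^ (k + 2))).map e) =
      LinearMap.ker (e ^ (k + 1)) := by
    apply le_antisymm
    · refine sup_le inf_le_right (sup_le ?_ ?_)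
      · intro v hv
        rw [LinearMap.mem_ker] at hv ⊢
        rw [pow_succ', Module.End.mul_apply, hv, map_zero]
      · rintro _ ⟨v, hv, rfl⟩
        rw [LinearMap.mem_ker, ← Module.End.mul_apply, ← pow_succ]
        exact hv
    · refine (L.le_iSup_inf (hstab (k + 1))).trans (iSup_le fun j => ?_)
      rintro v ⟨h0, hj⟩
      have h0' : (e ^ (k + 1)) v = 0 := h0
      -- Below weight `-k`, the Lefschetz injectivity leaves only zero. Above it, `e ^ k v = e ^ (k
      -- + 1) c` for some `c`, so `v - e c` lies in `ker e ^ k` and `c` in `ker e ^ (k + 2)`.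
      rcases lt_trichotomy j (-k) with hlt | rfl | hgt
      · obtain ⟨n, rfl⟩ : ∃ n : ℕ, j = -((n + (k + 1) : ℕ) : ℤ) := ⟨(-j - (k + 1)).toNat, by omega⟩
        rw [L.inj _ v hj (by rw [pow_add, Module.End.mul_apply, h0', map_zero])]
        exact Submodule.zero_mem _
      · exact Submodule.mem_sup_left ⟨hj, h0⟩
      · obtain ⟨c, hc, hcv⟩ := L.exists_pow_eq (a := j - 2) (m := k + 1) (by omega)
          (mem_wt_of_eq (L.pow_mem hj k) (by push_cast; ring))
        refine Submodule.mem_sup_right ?_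
        rw [← sub_add_cancel v (e c)]
        refine Submodule.add_mem_sup ?_ ⟨c, ?_, rfl⟩
        · rw [LinearMap.mem_ker, map_sub, ← hcv, pow_succ, Module.End.mul_apply, sub_self]
        · change (e ^ (k + 2)) c = 0
          rw [pow_succ', Module.End.mul_apply, hcv, ← Module.End.mul_apply, ← pow_succ', h0']
  have hinf : prim e h k ⊓ (LinearMap.ker (e ^ k) ⊔ (LinearMap.ker (e ^ (k + 2))).map e) = ⊥ := by
    rw [eq_bot_iff]
    rintro v ⟨hp, hv⟩
    -- The second space has no component of weight `-k`, where the primitive vectors live.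
    suffices hle : LinearMap.ker (e ^ k) ⊔ (LinearMap.ker (e ^ (k + 2))).map e ≤
        ⨆ (j : ℤ) (_ : j ≠ -(k : ℤ)), wt h j from
      Submodule.disjoint_def.1 (iSupIndep_wt h (-(k : ℤ))) v hp.1 (hle hv)
    refine sup_le ?_ ?_
    · refine (L.le_iSup_inf (hstab k)).trans (iSup_le fun j => ?_)
      rintro a ⟨ha, hj⟩
      by_cases hjk : j = -(k : ℤ)
      · subst hjk
        rw [L.inj k a hj ha]
        exact Submodule.zero_mem _
      · exact Submodule.mem_iSup_of_mem j (Submodule.mem_iSup_of_mem hjk hj)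
    · refine (Submodule.map_mono (L.le_iSup_inf (hstab (k + 2)))).trans ?_
      rw [Submodule.map_iSup]
      refine iSup_le fun j => ?_
      rintro _ ⟨c, ⟨hc, hj⟩, rfl⟩
      by_cases hjk : j + 2 = -(k : ℤ)
      · rw [L.inj (k + 2) c (mem_wt_of_eq hj (by push_cast; omega)) hc, map_zero]
        exact Submodule.zero_mem _
      · exact Submodule.mem_iSup_of_mem (j + 2)
          (Submodule.mem_iSup_of_mem hjk (mem_wt_add_two L.comm hj))
  have := Submodule.finrank_sup_add_finrank_inf_eq (prim e h k)
    (LinearMap.ker (e ^ k) ⊔ (LinearMap.ker (e ^ (k + 2))).map e)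
  rw [hinf, hsup, finrank_bot] at this
  omega

end IsLefschetz

end Strings

/-! ### Normal forms of symmetric and alternating forms -/

section StandardBasis

variable {𝕜 : Type u} [Field 𝕜] [CharZero 𝕜] [IsAlgClosed 𝕜]

/-- For orthogonal anisotropic `u` and `w`, the equation `β u u + c ^ 2 * β w w = 0` has a root `c`
in an algebraically closed field. -/
theorem exists_isotropic {M : Type v} [AddCommGroup M] [Module 𝕜 M] [FiniteDimensional 𝕜 M]
    (β : LinearMap.BilinForm 𝕜 M) (hβ : ∀ u v, β u v = β v u) (hd : 2 ≤ Module.finrank 𝕜 M) :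
    ∃ p, p ≠ 0 ∧ β p p = 0 := by
  have : Nontrivial M := Module.nontrivial_of_finrank_pos (R := 𝕜) (by omega)
  obtain ⟨u, hu⟩ := exists_ne (0 : M)
  by_cases huu : β u u = 0
  · exact ⟨u, hu, huu⟩
  have hker : 0 < Module.finrank 𝕜 (LinearMap.ker (β u)) := by
    have h1 := LinearMap.finrank_range_add_finrank_ker (β u)
    have h2 := Submodule.finrank_le (LinearMap.range (β u))
    rw [Module.finrank_self] at h2
    omega
  have := Module.nontrivial_of_finrank_pos hker
  obtain ⟨⟨w, hw⟩, hw0⟩ := exists_ne (0 : LinearMap.ker (β u))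
  have hw' : w ≠ 0 := fun h => hw0 (Subtype.ext h)
  have hw : β u w = 0 := hw
  by_cases hww : β w w = 0
  · exact ⟨w, hw', hww⟩
  obtain ⟨c, hc⟩ := IsAlgClosed.exists_pow_nat_eq (-(β u u) / β w w) (n := 2) (by norm_num)
  refine ⟨u + c • w, fun h0 => huu ?_, ?_⟩
  · have := congrArg (β u) h0
    simpa [hw] using this
  · have hwu : β w u = 0 := by rw [hβ, hw]
    simp only [map_add, LinearMap.add_apply, map_smul, LinearMap.smul_apply, smul_eq_mul, hw, hwu]
    rw [eq_div_iff hww] at hc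
    linear_combination hc

/-- A nondegenerate form which is symmetric (`δ = 1`) or alternating (`δ = -1`) has a basis with
antidiagonal Gram matrix, with entries `1` up to the middle and `δ` from there on. -/
theorem exists_antidiagonal_basis {δ : 𝕜} (hδ : δ = 1 ∨ δ = -1) (d : ℕ) :
    ∀ (M : Type v) [AddCommGroup M] [Module 𝕜 M] [FiniteDimensional 𝕜 M]
      (β : LinearMap.BilinForm 𝕜 M), (∀ u v, β u v = δ * β v u) →
      (∀ u, (∀ v, β u v = 0) → u = 0) → Module.finrank 𝕜 M = d →
      ∃ b : Module.Basis (Fin d) 𝕜 M, ∀ p q : Fin d, β (b p) (b q) =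
        if (p : ℕ) + q + 1 = d then (if (p : ℕ) ≤ q then 1 else δ) else 0 := by
  induction d using Nat.strong_induction_on with
  | _ d ih =>
  intro M _ _ _ β hβ hnd hd
  have halt : δ = -1 → ∀ u, β u u = 0 := by
    intro h u
    have := hβ u u
    rw [h] at this
    have h2 : (2 : 𝕜) * β u u = 0 := by linear_combination this
    simpa using h2
  match d, hd with
  | 0, hd => exact ⟨(Module.finBasis 𝕜 M).reindex (finCongr hd), fun p => p.elim0⟩
  | 1, hd =>
    set b := (Module.finBasis 𝕜 M).reindex (finCongr hd) with hb
    have h0 : β (b 0) (b 0) ≠ 0 := by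
      intro h0
      refine b.ne_zero 0 (hnd _ fun v => ?_)
      rw [← b.sum_repr v]
      simp [h0]
    obtain ⟨c, hc⟩ := IsAlgClosed.exists_pow_nat_eq (β (b 0) (b 0))⁻¹ (n := 2) (by norm_num)
    have hc0 : c ≠ 0 := by
      rintro rfl
      have : (β (b 0) (b 0))⁻¹ = 0 := by rw [← hc]; simp
      exact h0 (by simpa using this)
    refine ⟨b.isUnitSMul (w := fun _ => c) (fun _ => hc0.isUnit), fun p q => ?_⟩
    rw [Subsingleton.elim p 0, Subsingleton.elim q 0]
    simp only [Module.Basis.isUnitSMul_apply, map_smul, LinearMap.smul_apply, smul_eq_mul]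
    rw [← mul_assoc, ← sq, hc, inv_mul_cancel₀ h0]
    simp
  | d + 2, hd =>
    obtain ⟨p, hp0, hpp⟩ : ∃ p, p ≠ 0 ∧ β p p = 0 := by
      rcases hδ with rfl | h
      · exact exists_isotropic β (by simpa using hβ) (by omega)
      · have : Nontrivial M := Module.nontrivial_of_finrank_pos (R := 𝕜) (by omega)
        obtain ⟨u, hu⟩ := exists_ne (0 : M)
        exact ⟨u, hu, halt h u⟩
    obtain ⟨q, hpq, hqq⟩ : ∃ q, β p q = 1 ∧ β q q = 0 := by
      obtain ⟨r, hr⟩ : ∃ r, β p r ≠ 0 := by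
        by_contra! h
        exact hp0 (hnd p h)
      set q := (β p r)⁻¹ • r with hq
      have h1 : β p q = 1 := by simp [hq, hr]
      -- This makes `q` isotropic when `δ = 1`; in the alternating case the correction is zero.
      refine ⟨q - (β q q / 2) • p, by simp [h1, hpp], ?_⟩
      have h2 : β q p = δ := by rw [hβ, h1, mul_one]
      simp only [map_sub, LinearMap.sub_apply, map_smul, LinearMap.smul_apply, smul_eq_mul, hpp, h1,
        h2]
      rcases hδ with rfl | h
      · ring
      · rw [halt h]; ring
    have hqp : β q p = δ := by rw [hβ, hpq, mul_one]
    have hδ2 : δ * δ = 1 := by rcases hδ with rfl | rfl <;> ring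
    -- The orthogonal complement of the hyperbolic plane spanned by `p` and `q`; its standard basis,
    -- placed between `p` and `q`, gives an antidiagonal Gram matrix.
    set W := LinearMap.ker ((β p).prod (β q)) with hW
    have hmW : ∀ w, w ∈ W ↔ β p w = 0 ∧ β q w = 0 := by
      intro w; simp [hW, LinearMap.mem_ker]
    have hdec : ∀ z, z - β p z • q - (δ * β q z) • p ∈ W := by
      intro z
      rw [hmW]
      simp only [map_sub, map_smul, smul_eq_mul, hpp, hpq, hqq, hqp]
      constructor
      · ring
      · linear_combination (-β q z) * hδ2
    have hWd : Module.finrank 𝕜 W = d := by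
      have h1 := LinearMap.finrank_range_add_finrank_ker ((β p).prod (β q))
      have h2 : LinearMap.range ((β p).prod (β q)) = ⊤ := by
        rw [LinearMap.range_eq_top]
        rintro ⟨a, c⟩
        refine ⟨a • q + (δ * c) • p, Prod.ext ?_ ?_⟩
        · change β p (a • q + (δ * c) • p) = a
          simp [hpq, hpp]
        · change β q (a • q + (δ * c) • p) = c
          rw [map_add, map_smul, map_smul, hqq, hqp, smul_eq_mul, smul_eq_mul]
          linear_combination c * hδ2
      rw [h2, finrank_top, Module.finrank_prod, Module.finrank_self, ← hW] at h1
      omega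
    obtain ⟨b, hb⟩ := ih d (by omega) W (β.restrict W) (fun u v => hβ u v) (by
      rintro ⟨u, hu⟩ h0
      refine Subtype.ext (hnd u fun z => ?_)
      have h1 := h0 ⟨_, hdec z⟩
      have h2 : β u (z - β p z • q - (δ * β q z) • p) = 0 := h1
      obtain ⟨hu1, hu2⟩ := (hmW u).1 hu
      simpa [hβ u q, hβ u p, hu1, hu2] using h2) hWd
    set c : Fin (d + 2) → M := Fin.cons p (Fin.snoc (α := fun _ => M) (fun i => (b i : M)) q) with hc
    have c0 : c 0 = p := rfl
    have cl : c (Fin.last (d + 1)) = q := by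
      rw [← Fin.succ_last, hc, Fin.cons_succ, Fin.snoc_last]
    have cm : ∀ i : Fin d, c i.castSucc.succ = b i := by
      intro i
      rw [hc, Fin.cons_succ, Fin.snoc_castSucc]
    have hspan : ⊤ ≤ Submodule.span 𝕜 (Set.range c) := by
      intro z _
      have hp : p ∈ Submodule.span 𝕜 (Set.range c) := Submodule.subset_span ⟨0, c0⟩
      have hq : q ∈ Submodule.span 𝕜 (Set.range c) := Submodule.subset_span ⟨_, cl⟩
      have hw : ∀ w ∈ W, w ∈ Submodule.span 𝕜 (Set.range c) := by
        intro w hw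
        have h2 := Submodule.mem_map_of_mem (f := W.subtype) (b.mem_span ⟨w, hw⟩)
        rw [Submodule.map_span] at h2
        refine Submodule.span_mono ?_ h2
        rintro _ ⟨_, ⟨i, rfl⟩, rfl⟩
        exact ⟨_, cm i⟩
      have : z = (z - β p z • q - (δ * β q z) • p) + β p z • q + (δ * β q z) • p := by abel
      rw [this]
      exact Submodule.add_mem _ (Submodule.add_mem _ (hw _ (hdec z)) (Submodule.smul_mem _ _ hq))
        (Submodule.smul_mem _ _ hp)
    refine ⟨basisOfTopLeSpanOfCardEqFinrank c hspan (by simp [hd]), ?_⟩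
    rw [coe_basisOfTopLeSpanOfCardEqFinrank]
    have hbW : ∀ i, β p (b i) = 0 ∧ β q (b i) = 0 := fun i => (hmW _).1 (b i).2
    have hbW' : ∀ i, β (b i) p = 0 ∧ β (b i) q = 0 := fun i => by
      rw [hβ _ p, hβ _ q, (hbW i).1, (hbW i).2]; simp
    intro i j
    refine Fin.cases ?_ (fun i => ?_) i <;> refine Fin.cases ?_ (fun j => ?_) j
    · simp [c0, hpp]
    · refine Fin.lastCases ?_ (fun j => ?_) j
      · rw [Fin.succ_last, cl, c0, hpq]; simp
      · rw [cm, c0, (hbW j).1]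
        simp; omega
    · refine Fin.lastCases ?_ (fun i => ?_) i
      · rw [Fin.succ_last, cl, c0, hqp]; simp
      · rw [cm, c0, (hbW' i).1]
        simp; omega
    · refine Fin.lastCases ?_ (fun i => ?_) i <;> refine Fin.lastCases ?_ (fun j => ?_) j
      · rw [Fin.succ_last, cl, hqq]; simp
      · rw [Fin.succ_last, cl, cm, (hbW j).2]; simp
      · rw [Fin.succ_last, cl, cm, (hbW' i).2]; simp
      · rw [cm, cm]
        have := hb i j
        rw [LinearMap.BilinForm.restrict_apply] at this
        simp only [LinearMap.domRestrict_apply] at this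
        rw [this]
        simp only [Fin.val_succ, Fin.val_castSucc, add_le_add_iff_right]
        refine if_congr (by omega) rfl rfl

/-- For odd `d` the middle vector would pair with itself to `1`. -/
theorem even_of_antidiagonal {d : ℕ} {M : Type v} [AddCommGroup M] [Module 𝕜 M]
    (β : LinearMap.BilinForm 𝕜 M) (hβ : ∀ u, β u u = 0) (b : Fin d → M)
    (hb : ∀ p q : Fin d, (p : ℕ) + q + 1 = d → p ≤ q → β (b p) (b q) = 1) : Even d := by
  by_contra hodd
  rw [Nat.not_even_iff_odd] at hodd
  obtain ⟨m, rfl⟩ := hodd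
  have := hb ⟨m, by omega⟩ ⟨m, by omega⟩ (by simp; omega) le_rfl
  rw [hβ] at this
  exact zero_ne_one this

end StandardBasis

/-! ### Invariant forms on Jordan strings -/

section Forms

variable {𝕜 : Type u} [Field 𝕜] [CharZero 𝕜] {V : Type v} [AddCommGroup V] [Module 𝕜 V]
  {Φ : LinearMap.BilinForm 𝕜 V} {e h : Module.End 𝕜 V}

/-- `e` is skew-adjoint for `Φ`. -/
def IsSkew (Φ : LinearMap.BilinForm 𝕜 V) (e : Module.End 𝕜 V) : Prop :=
  ∀ a b, Φ (e a) b = -Φ a (e b)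

theorem IsSkew.pow (he : IsSkew Φ e) (i : ℕ) (a b : V) :
    Φ ((e ^ i) a) b = (-1) ^ i * Φ a ((e ^ i) b) := by
  induction i generalizing a b with
  | zero => simp
  | succ i ih =>
    rw [pow_succ' e, Module.End.mul_apply, he, ih, ← Module.End.mul_apply, ← pow_succ, pow_succ',
      pow_succ']
    ring

theorem IsSkew.eq_zero_of_wt (hh : IsSkew Φ h) {i j : ℤ} (hij : i + j ≠ 0) {a b : V}
    (ha : a ∈ wt h i) (hb : b ∈ wt h j) : Φ a b = 0 := by
  have h1 := hh a b
  rw [mem_wt.1 ha, mem_wt.1 hb, map_smul, map_smul, LinearMap.smul_apply, smul_eq_mul,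
    smul_eq_mul] at h1
  have h2 : ((i + j : ℤ) : 𝕜) * Φ a b = 0 := by push_cast; linear_combination h1
  exact (mul_eq_zero.1 h2).resolve_left (by exact_mod_cast hij)

/-- Skewness of `h` allows only opposite weights to pair. For `k ≠ l` opposite weights force `i + j`
to exceed the smaller of `k` and `l`, and moving all powers of `e` onto the shorter string gives
zero. -/
theorem IsLefschetz.form_strings (L : IsLefschetz e h) (he : IsSkew Φ e) (hh : IsSkew Φ h)
    {k l : ℕ} {u w : V} (hu : u ∈ prim e h k) (hw : w ∈ prim e h l) (i j : ℕ) :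
    Φ ((e ^ i) u) ((e ^ j) w) =
      if k = l ∧ i + j = k then (-1) ^ i * Φ u ((e ^ k) w) else 0 := by
  rw [he.pow, ← Module.End.mul_apply, ← pow_add]
  split_ifs with hkl
  · rw [hkl.2]
  · by_cases hwt : -(k : ℤ) + (-l + 2 * (i + j : ℕ)) = 0
    · have hne : k ≠ l := fun h => hkl ⟨h, by omega⟩
      rcases lt_or_gt_of_ne hne with hlt | hgt
      · have h1 := he.pow (i + j) u w
        obtain ⟨c, hc⟩ : ∃ c, i + j = c + (k + 1) := ⟨i + j - (k + 1), by omega⟩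
        have h2 : (e ^ (i + j)) u = 0 := by
          rw [hc, pow_add, Module.End.mul_apply, (mem_prim.1 hu).2, map_zero]
        rw [h2, map_zero, LinearMap.zero_apply] at h1
        have h3 := (mul_eq_zero.1 h1.symm).resolve_left (pow_ne_zero _ (by norm_num))
        rw [h3, mul_zero]
      · obtain ⟨c, hc⟩ : ∃ c, i + j = c + (l + 1) := ⟨i + j - (l + 1), by omega⟩
        rw [hc, pow_add, Module.End.mul_apply, (mem_prim.1 hw).2, map_zero, map_zero, mul_zero]
    · rw [hh.eq_zero_of_wt hwt hu.1 (L.pow_mem hw.1 _), mul_zero]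

/-- The form `(u, w) ↦ Φ u (e ^ k w)` on the primitive vectors of weight `-k`. -/
noncomputable def primForm (Φ : LinearMap.BilinForm 𝕜 V) (e h : Module.End 𝕜 V) (k : ℕ) :
    LinearMap.BilinForm 𝕜 (prim e h k) :=
  LinearMap.compl₁₂ Φ (prim e h k).subtype ((e ^ k) ∘ₗ (prim e h k).subtype)

theorem primForm_apply (k : ℕ) (u w : prim e h k) : primForm Φ e h k u w = Φ u ((e ^ k) (w : V)) :=
  rfl

/-- Moving `e ^ k` across the form costs `(-1) ^ k`, so the symmetry type alternates with `k`. -/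
theorem primForm_symm {ε : 𝕜} (hε : ∀ a b, Φ a b = ε * Φ b a) (he : IsSkew Φ e) (k : ℕ)
    (u w : prim e h k) : primForm Φ e h k u w = ((-1) ^ k * ε) * primForm Φ e h k w u := by
  rw [primForm_apply, primForm_apply, hε, he.pow]
  ring

/-- A primitive `u` can only pair with weight `k`, whose vectors are `e ^ k (p + e z)` with `p`
primitive. The term `e ^ (k + 1) z` contributes nothing because `e ^ (k + 1) u = 0`. -/
theorem IsLefschetz.primForm_nondegenerate (L : IsLefschetz e h) (he : IsSkew Φ e)
    (hh : IsSkew Φ h) (hnd : ∀ u, (∀ v, Φ u v = 0) → u = 0) (k : ℕ) (u : prim e h k)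
    (hu : ∀ w, primForm Φ e h k u w = 0) : u = 0 := by
  refine Subtype.ext (hnd u fun v => ?_)
  have hv : v ∈ ⨆ j : ℤ, wt h j := by rw [L.span]; trivial
  induction hv using Submodule.iSup_induction' with
  | mem j v hv =>
    by_cases hj : j = k
    · subst hj
      obtain ⟨w, hw, rfl⟩ := L.surj k v hv
      obtain ⟨p, hp, z, hz, rfl⟩ := L.exists_prim_add k hw
      rw [map_add, map_add]
      have h1 : Φ u ((e ^ k) p) = 0 := hu ⟨p, hp⟩
      have h2 := he.pow (k + 1) (u : V) z
      rw [u.2.2, map_zero, LinearMap.zero_apply] at h2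
      have h3 := (mul_eq_zero.1 h2.symm).resolve_left (pow_ne_zero _ (by norm_num))
      rw [pow_succ, Module.End.mul_apply] at h3
      rw [h1, h3, add_zero]
    · exact hh.eq_zero_of_wt (by omega) u.2.1 hv
  | zero => simp
  | add x y _ _ hx hy => rw [map_add, hx, hy, add_zero]

variable [IsAlgClosed 𝕜] [FiniteDimensional 𝕜 V]

theorem sign_pow {ε : 𝕜} (hε : ε = 1 ∨ ε = -1) (k : ℕ) :
    (-1) ^ k * ε = 1 ∨ (-1) ^ k * ε = -1 := by
  rcases neg_one_pow_eq_or 𝕜 k with h | h <;> rcases hε with rfl | rfl <;> simp [h]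

theorem IsLefschetz.exists_prim_basis (L : IsLefschetz e h) {ε : 𝕜} (hε : ε = 1 ∨ ε = -1)
    (hΦ : ∀ a b, Φ a b = ε * Φ b a) (he : IsSkew Φ e) (hh : IsSkew Φ h)
    (hnd : ∀ u, (∀ v, Φ u v = 0) → u = 0) (k d : ℕ) (hd : Module.finrank 𝕜 (prim e h k) = d) :
    ∃ b : Module.Basis (Fin d) 𝕜 (prim e h k), ∀ p q : Fin d,
      Φ (b p) ((e ^ k) (b q : V)) =
        if (p : ℕ) + q + 1 = d then (if (p : ℕ) ≤ q then 1 else (-1) ^ k * ε) else 0 :=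
  exists_antidiagonal_basis (sign_pow hε k) d (prim e h k) (primForm Φ e h k)
    (primForm_symm hΦ he k) (L.primForm_nondegenerate he hh hnd k) hd

/-- A basis of Jordan strings in which the form has a standard Gram matrix. -/
theorem IsLefschetz.exists_form_basis (L : IsLefschetz e h) {ε : 𝕜} (hε : ε = 1 ∨ ε = -1)
    (hΦ : ∀ a b, Φ a b = ε * Φ b a) (he : IsSkew Φ e) (hh : IsSkew Φ h)
    (hnd : ∀ u, (∀ v, Φ u v = 0) → u = 0) (d : ℕ → ℕ)
    (hd : ∀ k, Module.finrank 𝕜 (prim e h k) = d k) :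
    ∃ b : Module.Basis (Σ k, Fin (d k) × Fin (k + 1)) 𝕜 V,
      (∀ k p (i : Fin (k + 1)), e (b ⟨k, p, i⟩) =
        if hi : (i : ℕ) + 1 < k + 1 then b ⟨k, p, ⟨i + 1, hi⟩⟩ else 0) ∧
      (∀ k p (i : Fin (k + 1)), b ⟨k, p, i⟩ ∈ wt h (-k + 2 * (i : ℕ))) ∧
      ∀ k p (i : Fin (k + 1)) l q (j : Fin (l + 1)), Φ (b ⟨k, p, i⟩) (b ⟨l, q, j⟩) =
        if k = l ∧ (p : ℕ) + q + 1 = d k ∧ (i : ℕ) + j = k then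
          (-1) ^ (i : ℕ) * (if (p : ℕ) ≤ q then 1 else (-1) ^ k * ε) else 0 := by
  choose b hb using fun k => L.exists_prim_basis hε hΦ he hh hnd k (d k) (hd k)
  refine ⟨L.stringBasis b, L.e_stringBasis b, L.stringBasis_mem_wt b, ?_⟩
  intro k p i l q j
  rw [stringBasis_apply, stringBasis_apply, L.form_strings he hh (b k p).2 (b l q).2]
  by_cases hkl : k = l
  · subst hkl
    rw [hb]
    by_cases hij : (i : ℕ) + j = k <;> by_cases hpq : (p : ℕ) + q + 1 = d k <;> simp [hij, hpq]
  · simp [hkl]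

/-- With this sign the induced form on primitive vectors is alternating and nondegenerate. -/
theorem IsLefschetz.even_finrank_prim (L : IsLefschetz e h) {ε : 𝕜}
    (hΦ : ∀ a b, Φ a b = ε * Φ b a) (he : IsSkew Φ e) (hh : IsSkew Φ h)
    (hnd : ∀ u, (∀ v, Φ u v = 0) → u = 0) (k : ℕ) (hk : (-1) ^ k * ε = -1) :
    Even (Module.finrank 𝕜 (prim e h k)) := by
  have hs := primForm_symm (h := h) hΦ he k
  rw [hk] at hs
  obtain ⟨b, hb⟩ := exists_antidiagonal_basis (Or.inr rfl) _ (prim e h k) (primForm Φ e h k)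
    hs (L.primForm_nondegenerate he hh hnd k) rfl
  refine even_of_antidiagonal (primForm Φ e h k) (fun u => ?_) b fun p q h1 h2 => ?_
  · have h1 := hs u u
    have h2 : (2 : 𝕜) * primForm Φ e h k u u = 0 := by linear_combination h1
    simpa using h2
  · rw [hb, if_pos h1, if_pos (Fin.le_def.1 h2)]

end Forms

/-! ### Conjugacy of Lefschetz pairs under the classical groups -/

section Conjugacy

variable {𝕜 : Type u} [Field 𝕜] [CharZero 𝕜] {V : Type v} [AddCommGroup V] [Module 𝕜 V]

theorem mem_slGroup {a : V ≃ₗ[𝕜] V} :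
    a ∈ slGroup 𝕜 V ↔ LinearMap.det (a : V →ₗ[𝕜] V) = 1 := by
  rw [slGroup, MonoidHom.mem_ker, ← LinearEquiv.coe_det, Units.val_eq_one]

theorem conj_eq_iff {a : V ≃ₗ[𝕜] V} {x y : Module.End 𝕜 V} :
    a.conj x = y ↔ ∀ v, a (x v) = y (a v) := by
  constructor
  · rintro rfl v
    simp [LinearEquiv.conj_apply]
  · intro h
    ext v
    simp [LinearEquiv.conj_apply, h]

theorem conj_eq_of_basis {J : Type*} (b : Module.Basis J 𝕜 V) {a : V ≃ₗ[𝕜] V}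
    {x y : Module.End 𝕜 V} (h : ∀ j, a (x (b j)) = y (a (b j))) : a.conj x = y := by
  rw [conj_eq_iff]
  have : (a : V →ₗ[𝕜] V) ∘ₗ x = y ∘ₗ (a : V →ₗ[𝕜] V) := b.ext fun j => h j
  exact fun v => LinearMap.congr_fun this v

theorem mem_isometryGroup_of_basis {Φ : LinearMap.BilinForm 𝕜 V} {J : Type*}
    (b : Module.Basis J 𝕜 V) {a : V ≃ₗ[𝕜] V}
    (h : ∀ i j, Φ (a (b i)) (a (b j)) = Φ (b i) (b j)) : a ∈ isometryGroup Φ := by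
  have : LinearMap.BilinForm.comp Φ (a : V →ₗ[𝕜] V) (a : V →ₗ[𝕜] V) = Φ :=
    LinearMap.BilinForm.ext_basis b fun i j => h i j
  intro u v
  conv_rhs => rw [← this]
  rfl

theorem conj_trans {a c : V ≃ₗ[𝕜] V} {x y z : Module.End 𝕜 V} (h1 : a.conj x = y)
    (h2 : c.conj y = z) : (c * a).conj x = z := by
  rw [conj_eq_iff] at h1 h2 ⊢
  intro v
  change c (a (x v)) = z (c (a v))
  rw [h1, h2]

variable [FiniteDimensional 𝕜 V]

theorem det_sq_of_mem_isometryGroup {Φ : LinearMap.BilinForm 𝕜 V} (hΦ : Φ.Nondegenerate)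
    {a : V ≃ₗ[𝕜] V} (ha : a ∈ isometryGroup Φ) :
    LinearMap.det (a : V →ₗ[𝕜] V) = 1 ∨ LinearMap.det (a : V →ₗ[𝕜] V) = -1 := by
  classical
  set b := Module.finBasis 𝕜 V
  have h1 : LinearMap.BilinForm.comp Φ (a : V →ₗ[𝕜] V) (a : V →ₗ[𝕜] V) = Φ :=
    LinearMap.BilinForm.ext_basis b fun i j => ha _ _
  have h2 := LinearMap.BilinForm.toMatrix_comp b b Φ (a : V →ₗ[𝕜] V) (a : V →ₗ[𝕜] V)
  rw [h1] at h2
  have h3 := congrArg Matrix.det h2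
  rw [Matrix.det_mul, Matrix.det_mul, Matrix.det_transpose, LinearMap.det_toMatrix] at h3
  have h4 := (LinearMap.BilinForm.nondegenerate_iff_det_ne_zero b).1 hΦ
  rw [← sq_eq_one_iff]
  apply mul_right_cancel₀ h4
  linear_combination -h3

/-- The actions of `e` and `h` on a string basis depend only on the lengths of the strings, so
matching two string bases conjugates the pairs. -/
theorem IsLefschetz.exists_conj {e h e' h' : Module.End 𝕜 V} (L : IsLefschetz e h)
    (L' : IsLefschetz e' h')
    (hd : ∀ k, Module.finrank 𝕜 (prim e h k) = Module.finrank 𝕜 (prim e' h' k)) :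
    ∃ a : V ≃ₗ[𝕜] V, a.conj e = e' ∧ a.conj h = h' := by
  set b := L.stringBasis fun k => Module.finBasis 𝕜 (prim e h k)
  set b' := L'.stringBasis fun k => (Module.finBasis 𝕜 (prim e' h' k)).reindex (finCongr (hd k).symm)
  have hab : ∀ j, (b.equiv b' (Equiv.refl _)) (b j) = b' j := fun j => by simp
  refine ⟨b.equiv b' (Equiv.refl _), conj_eq_of_basis b ?_, conj_eq_of_basis b ?_⟩
  · rintro ⟨k, p, i⟩
    rw [hab, e_stringBasis, e_stringBasis]
    split_ifs
    · rw [hab]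
    · rw [map_zero]
  · rintro ⟨k, p, i⟩
    have h1 := mem_wt.1 (L.stringBasis_mem_wt (fun k => Module.finBasis 𝕜 (prim e h k)) k p i)
    have h2 := mem_wt.1 (L'.stringBasis_mem_wt
      (fun k => (Module.finBasis 𝕜 (prim e' h' k)).reindex (finCongr (hd k).symm)) k p i)
    rw [hab, h2, h1, map_smul, hab]

theorem smul_conj (a : V ≃ₗ[𝕜] V) {c : 𝕜} (hc : c ≠ 0) {x y : Module.End 𝕜 V}
    (h : a.conj x = y) : (a.trans (LinearEquiv.smulOfNeZero 𝕜 V c hc)).conj x = y := by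
  rw [conj_eq_iff] at h ⊢
  intro v
  simp [h]

variable [IsAlgClosed 𝕜]

theorem IsLefschetz.exists_conj_sl {e h e' h' : Module.End 𝕜 V} (L : IsLefschetz e h)
    (L' : IsLefschetz e' h')
    (hd : ∀ k, Module.finrank 𝕜 (prim e h k) = Module.finrank 𝕜 (prim e' h' k)) :
    ∃ a ∈ slGroup 𝕜 V, a.conj e = e' ∧ a.conj h = h' := by
  obtain ⟨a, hae, hah⟩ := L.exists_conj L' hd
  by_cases hV : Module.finrank 𝕜 V = 0
  · exact ⟨a, mem_slGroup.2 (LinearMap.det_eq_one_of_finrank_eq_zero hV _), hae, hah⟩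
  -- Scalars commute with everything, so a `dim V`-th root of the inverse determinant may be
  -- multiplied in.
  obtain ⟨c, hc⟩ := IsAlgClosed.exists_pow_nat_eq
    (LinearMap.det (a : V →ₗ[𝕜] V))⁻¹ (Nat.pos_of_ne_zero hV)
  have hdet : LinearMap.det (a : V →ₗ[𝕜] V) ≠ 0 := by
    rw [← LinearEquiv.coe_det]; exact Units.ne_zero _
  have hc0 : c ≠ 0 := by
    rintro rfl
    rw [zero_pow hV] at hc
    exact inv_ne_zero hdet hc.symm
  refine ⟨a.trans (LinearEquiv.smulOfNeZero 𝕜 V c hc0), ?_, smul_conj a hc0 hae, smul_conj a hc0 hah⟩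
  rw [mem_slGroup]
  have : ((a.trans (LinearEquiv.smulOfNeZero 𝕜 V c hc0) : V ≃ₗ[𝕜] V) : V →ₗ[𝕜] V) =
      c • (a : V →ₗ[𝕜] V) := by
    ext v; simp
  rw [this, LinearMap.det_smul, hc, inv_mul_cancel₀ hdet]

/-- The Gram matrix of a standard string basis depends only on `ε` and the string numbers, so
matching two such bases is an isometry. -/
theorem IsLefschetz.exists_conj_isometry {Φ : LinearMap.BilinForm 𝕜 V} {ε : 𝕜}
    (hε : ε = 1 ∨ ε = -1) (hΦ : ∀ a b, Φ a b = ε * Φ b a)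
    (hnd : ∀ u, (∀ v, Φ u v = 0) → u = 0) {e h e' h' : Module.End 𝕜 V} (L : IsLefschetz e h)
    (L' : IsLefschetz e' h') (he : IsSkew Φ e) (hh : IsSkew Φ h) (he' : IsSkew Φ e')
    (hh' : IsSkew Φ h')
    (hd : ∀ k, Module.finrank 𝕜 (prim e h k) = Module.finrank 𝕜 (prim e' h' k)) :
    ∃ a ∈ isometryGroup Φ, a.conj e = e' ∧ a.conj h = h' := by
  obtain ⟨b, hbe, hbh, hbΦ⟩ := L.exists_form_basis hε hΦ he hh hnd _ (fun k => rfl)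
  obtain ⟨b', hbe', hbh', hbΦ'⟩ := L'.exists_form_basis hε hΦ he' hh' hnd _ (fun k => (hd k).symm)
  have hab : ∀ j, (b.equiv b' (Equiv.refl _)) (b j) = b' j := fun j => by simp
  refine ⟨b.equiv b' (Equiv.refl _), mem_isometryGroup_of_basis b ?_, conj_eq_of_basis b ?_,
    conj_eq_of_basis b ?_⟩
  · rintro ⟨k, p, i⟩ ⟨l, q, j⟩
    rw [hab, hab, hbΦ, hbΦ']
  · rintro ⟨k, p, i⟩
    rw [hab, hbe, hbe']
    split_ifs
    · rw [hab]
    · rw [map_zero]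
  · rintro ⟨k, p, i⟩
    rw [hab, mem_wt.1 (hbh k p i), mem_wt.1 (hbh' k p i), map_smul, hab]

/-- Without primitive vectors of even degree, weight `-2m` is the image under `e` of weight `-2(m +
1)` for every `m`; weight `0` then lies in the image of every power of the nilpotent `e`. -/
theorem IsLefschetz.exists_even_prim {e h : Module.End 𝕜 V} (L : IsLefschetz e h)
    (h0 : wt h 0 ≠ ⊥) : ∃ m : ℕ, prim e h (2 * m) ≠ ⊥ := by
  by_contra! hp
  apply h0
  rw [eq_bot_iff]
  intro v hv
  have key : ∀ n m : ℕ, ∀ v ∈ wt h (-(2 * m : ℕ)), ∃ c, v = (e ^ n) c := by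
    intro n
    induction n with
    | zero => intro m v _; exact ⟨v, by simp⟩
    | succ n ih =>
      intro m v hv
      obtain ⟨p, hpm, w, hw, rfl⟩ := L.exists_prim_add (2 * m) hv
      rw [hp, Submodule.mem_bot] at hpm
      obtain ⟨c, rfl⟩ := ih (m + 1) w hw
      exact ⟨c, by rw [hpm, zero_add, pow_succ', Module.End.mul_apply]⟩
  obtain ⟨N, hN⟩ := isNilpotent_of_raising L.comm
  obtain ⟨c, rfl⟩ := key N 0 v (by simpa using hv)
  simp [hN]

/-- A Jordan block of odd size on which the form is nondegenerate gives an isometry of determinant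
`-1` centralising `e` and `h`. -/
theorem IsLefschetz.exists_reflection {Φ : LinearMap.BilinForm 𝕜 V}
    (hΦ : ∀ a b, Φ a b = Φ b a) {e h : Module.End 𝕜 V} (L : IsLefschetz e h) (he : IsSkew Φ e)
    (hh : IsSkew Φ h) {m : ℕ} (hm : prim e h (2 * m) ≠ ⊥) :
    ∃ a ∈ isometryGroup Φ, a.conj e = e ∧ a.conj h = h ∧ LinearMap.det (a : V →ₗ[𝕜] V) = -1 := by
  classical
  -- In degree `2m` an orthogonal basis is needed, unlike the antidiagonal one, so that changing the
  -- sign of a single string preserves the form.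
  have hB : ∀ k, ∃ b : Module.Basis (Fin (Module.finrank 𝕜 (prim e h k))) 𝕜 (prim e h k),
      k = 2 * m → ∀ p q, p ≠ q → primForm Φ e h k (b p) (b q) = 0 := by
    intro k
    by_cases hk : k = 2 * m
    · have : Invertible (2 : 𝕜) := invertibleOfNonzero two_ne_zero
      have hs : LinearMap.IsSymm (primForm Φ e h k) := ⟨fun u w => by
        have := primForm_symm (ε := 1) (h := h) (by simpa using hΦ) he k u w
        have h1 : (-1 : 𝕜) ^ k = 1 := by rw [hk, pow_mul]; simp
        rw [h1] at this
        simpa using this⟩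
      obtain ⟨b, hb⟩ := LinearMap.BilinForm.exists_orthogonal_basis hs
      exact ⟨b, fun _ p q hpq => hb hpq⟩
    · exact ⟨Module.finBasis 𝕜 _, fun h => absurd h hk⟩
  choose B hB using hB
  set b := L.stringBasis B with hb
  -- The sign changes on exactly one string of length `2m + 1`, an odd number of basis vectors,
  -- whence determinant `-1`.
  set s : (Σ k, Fin (Module.finrank 𝕜 (prim e h k)) × Fin (k + 1)) → 𝕜 :=
    fun x => if x.1 = 2 * m ∧ (x.2.1 : ℕ) = 0 then -1 else 1 with hs
  have hs2 : ∀ x, s x * s x = 1 := by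
    intro x; simp only [hs]; split_ifs <;> simp
  have hs0 : ∀ x, s x ≠ 0 := fun x h0 => by simpa [h0] using hs2 x
  set a := b.equiv (b.isUnitSMul (w := s) fun x => (hs0 x).isUnit) (Equiv.refl _) with ha
  have hab : ∀ j, a (b j) = s j • b j := fun j => by
    rw [ha, Module.Basis.equiv_apply, Module.Basis.isUnitSMul_apply]; rfl
  refine ⟨a, mem_isometryGroup_of_basis b ?_, conj_eq_of_basis b ?_, conj_eq_of_basis b ?_, ?_⟩
  · rintro ⟨k, p, i⟩ ⟨l, q, j⟩
    rw [hab, hab, map_smul, map_smul, LinearMap.smul_apply, smul_eq_mul, smul_eq_mul]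
    by_cases h0 : Φ (b ⟨k, p, i⟩) (b ⟨l, q, j⟩) = 0
    · rw [h0]; simp
    · rw [hb, stringBasis_apply, stringBasis_apply,
        L.form_strings he hh (B k p).2 (B l q).2] at h0
      have hkl : k = l := by
        by_contra hkl; simp [hkl] at h0
      subst hkl
      have h1 : s ⟨k, p, i⟩ = s ⟨k, q, j⟩ := by
        by_cases hk : k = 2 * m
        · have hpq : p = q := by
            by_contra hpq
            have := hB k hk p q hpq
            rw [primForm_apply] at this
            simp [this] at h0
          subst hpq; rfl
        · simp [hs, hk]
      rw [h1, ← mul_assoc, hs2, one_mul]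
  · rintro ⟨k, p, i⟩
    rw [hab, map_smul, hb, e_stringBasis, ← hb]
    split_ifs
    · rw [hab]
    · rw [map_zero, smul_zero]
  · rintro ⟨k, p, i⟩
    rw [hab, map_smul, hb, mem_wt.1 (L.stringBasis_mem_wt B k p i), ← hb, map_smul, hab, smul_comm]
  · have := FiniteDimensional.fintypeBasisIndex b
    have hmat : LinearMap.toMatrix b b (a : V →ₗ[𝕜] V) = Matrix.diagonal s := by
      ext i j
      rw [LinearMap.toMatrix_apply]
      change (b.repr (a (b j))) i = _
      rw [hab, map_smul, Module.Basis.repr_self, Matrix.diagonal_apply]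
      by_cases hij : i = j
      · subst hij; simp
      · simp [hij]
    rw [← LinearMap.det_toMatrix b, hmat, Matrix.det_diagonal]
    have hpos : 0 < Module.finrank 𝕜 (prim e h (2 * m)) :=
      Nat.pos_of_ne_zero fun h0 => hm (Submodule.finrank_eq_zero.1 h0)
    have hinj : Function.Injective fun i : Fin (2 * m + 1) =>
        (⟨2 * m, ⟨0, hpos⟩, i⟩ : Σ k, Fin (Module.finrank 𝕜 (prim e h k)) × Fin (k + 1)) := by
      intro i j hij
      simpa using hij
    rw [← Finset.prod_subset (Finset.subset_univ (Finset.univ.image fun i : Fin (2 * m + 1) =>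
        (⟨2 * m, ⟨0, hpos⟩, i⟩ : Σ k, Fin (Module.finrank 𝕜 (prim e h k)) × Fin (k + 1)))),
      Finset.prod_image hinj.injOn]
    · simp [hs, pow_succ, pow_mul]
    · rintro ⟨k, p, i⟩ _ hnot
      simp only [hs]
      rw [if_neg]
      rintro ⟨hk, hp⟩
      subst hk
      apply hnot
      rw [Finset.mem_image]
      have hp0 : p = ⟨0, hpos⟩ := Fin.ext hp
      exact ⟨i, Finset.mem_univ _, by rw [hp0]⟩

theorem IsLefschetz.exists_conj_special_isometry {Φ : LinearMap.BilinForm 𝕜 V}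
    (hΦ : ∀ a b, Φ a b = Φ b a) (hnd : Φ.Nondegenerate)
    {e h e' h' : Module.End 𝕜 V} (L : IsLefschetz e h)
    (L' : IsLefschetz e' h') (he : IsSkew Φ e) (hh : IsSkew Φ h) (he' : IsSkew Φ e')
    (hh' : IsSkew Φ h')
    (hd : ∀ k, Module.finrank 𝕜 (prim e h k) = Module.finrank 𝕜 (prim e' h' k))
    (h0 : wt h 0 ≠ ⊥ ∨ Subsingleton V) :
    ∃ a ∈ isometryGroup Φ ⊓ slGroup 𝕜 V, a.conj e = e' ∧ a.conj h = h' := by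
  obtain ⟨a, ha, hae, hah⟩ := L.exists_conj_isometry (Or.inl rfl) (by simpa using hΦ)
    hnd.1 L' he hh he' hh' hd
  rcases det_sq_of_mem_isometryGroup hnd ha with h1 | h1
  · exact ⟨a, ⟨ha, mem_slGroup.2 h1⟩, hae, hah⟩
  rcases h0 with h0 | h0
  -- A conjugator of determinant `-1` is corrected by a reflection centralising `e` and `h`; weight
  -- `0` provides the odd string it needs.
  · obtain ⟨m, hm⟩ := L.exists_even_prim h0
    obtain ⟨c, hc, hce, hch, hcd⟩ := L.exists_reflection hΦ he hh hm
    refine ⟨a * c, ⟨mul_mem ha hc, mem_slGroup.2 ?_⟩, conj_trans hce hae, conj_trans hch hah⟩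
    have : ((a * c : V ≃ₗ[𝕜] V) : V →ₗ[𝕜] V) = (a : V →ₗ[𝕜] V) ∘ₗ (c : V →ₗ[𝕜] V) := rfl
    rw [this, LinearMap.det_comp, h1, hcd]; ring
  · exact ⟨a, ⟨ha, mem_slGroup.2 (LinearMap.det_eq_one_of_finrank_eq_zero
      (Module.finrank_zero_of_subsingleton) _)⟩, hae, hah⟩

end Conjugacy

/-! ### From halved diagrams to half characteristics -/

section Friendly

variable {𝕜 : Type u} [Field 𝕜] [CharZero 𝕜] {V : Type v} [AddCommGroup V] [Module 𝕜 V]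

theorem IsTriple.coe {g : LieSubalgebra 𝕜 (Module.End 𝕜 V)} {e h f : g} (t : IsTriple e h f) :
    IsTriple (e : Module.End 𝕜 V) h f where
  lie_e_f := congrArg Subtype.val t.lie_e_f
  lie_h_e := congrArg Subtype.val t.lie_h_e
  lie_h_f := congrArg Subtype.val t.lie_h_f

theorem IsTriple.of_coe {g : LieSubalgebra 𝕜 (Module.End 𝕜 V)} {e h f : g}
    (t : IsTriple (e : Module.End 𝕜 V) h f) : IsTriple e h f where
  lie_e_f := Subtype.ext t.lie_e_f
  lie_h_e := Subtype.ext t.lie_h_e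
  lie_h_f := Subtype.ext t.lie_h_f

theorem IsTriple.conj {e h f : Module.End 𝕜 V} (t : IsTriple e h f) (a : V ≃ₗ[𝕜] V) :
    IsTriple (a.conj e) (a.conj h) (a.conj f) := by
  have hl : ∀ x y : Module.End 𝕜 V, ⁅a.conj x, a.conj y⁆ = a.conj ⁅x, y⁆ := fun x y =>
    (LieEquiv.map_lie a.lieConj x y).symm
  refine ⟨?_, ?_, ?_⟩
  · rw [hl, t.lie_e_f]
  · rw [hl, t.lie_h_e, map_nsmul]
  · rw [hl, t.lie_h_f, map_neg, map_nsmul]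

theorem mul_conj (a c : V ≃ₗ[𝕜] V) (x : Module.End 𝕜 V) : (c * a).conj x = c.conj (a.conj x) :=
  conj_trans rfl rfl

theorem inv_conj_conj (a : V ≃ₗ[𝕜] V) (x : Module.End 𝕜 V) : a⁻¹.conj (a.conj x) = x := by
  rw [← mul_conj, inv_mul_cancel, conj_eq_iff]
  intro v; rfl

theorem wt_half (h : Module.End 𝕜 V) (k : ℤ) : wt ((2⁻¹ : 𝕜) • h) k = wt h (2 * k) := by
  ext v
  rw [mem_wt, mem_wt, LinearMap.smul_apply, inv_smul_eq_iff₀ two_ne_zero, smul_smul]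
  push_cast
  rfl

/-- If `h / 2` is diagonalisable with integral weights, the weights of `h` are even. -/
theorem wt_eq_bot_of_odd {h : Module.End 𝕜 V} (hs : ⨆ k : ℤ, wt ((2⁻¹ : 𝕜) • h) k = ⊤) {j : ℤ}
    (hj : Odd j) : wt h j = ⊥ := by
  have h1 := iSupIndep_wt h j
  have h2 : (⊤ : Submodule 𝕜 V) ≤ ⨆ (i : ℤ) (_ : i ≠ j), wt h i := by
    rw [← hs]
    refine iSup_le fun k => ?_
    rw [wt_half]
    refine le_iSup₂_of_le (f := fun (i : ℤ) (_ : i ≠ j) => wt h i) (2 * k) ?_ le_rfl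
    rintro rfl
    exact (Int.not_odd_iff_even.2 (even_two_mul k)) hj
  have := h1.mono_right h2
  rwa [disjoint_top] at this

/-- When all weights are even, the injective map `e ^ (2m)` on weight `-2m` factors through weight
`0`; if weight `0` is zero, so is `V`. -/
theorem IsLefschetz.wt_zero_ne_bot {e h : Module.End 𝕜 V} (L : IsLefschetz e h)
    (ho : ∀ j : ℤ, Odd j → wt h j = ⊥) : wt h 0 ≠ ⊥ ∨ Subsingleton V := by
  by_cases h0 : wt h 0 = ⊥
  swap
  · exact Or.inl h0
  right
  have hneg : ∀ n : ℕ, wt h (-n) = ⊥ := by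
    intro n
    rcases Nat.even_or_odd n with ⟨m, rfl⟩ | hn
    · rw [eq_bot_iff]
      intro v hv
      have h1 : (e ^ m) v ∈ wt h 0 := mem_wt_of_eq (L.pow_mem hv m) (by push_cast; ring)
      rw [h0, Submodule.mem_bot] at h1
      exact L.inj _ v hv (by rw [pow_add, Module.End.mul_apply, h1, map_zero])
    · exact ho _ (by simpa using hn)
  have hall : ∀ j : ℤ, wt h j = ⊥ := by
    intro j
    obtain ⟨n, rfl | rfl⟩ := j.eq_nat_or_neg
    · rw [eq_bot_iff]
      intro v hv
      obtain ⟨u, hu, rfl⟩ := L.surj n v hv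
      rw [hneg, Submodule.mem_bot] at hu
      simp [hu]
    · exact hneg n
  have := L.span
  simp only [hall, iSup_bot] at this
  rw [← Submodule.subsingleton_iff 𝕜]
  exact subsingleton_of_bot_eq_top this

variable [FiniteDimensional 𝕜 V]

theorem finrank_prim_eq_of_left {e h h' : Module.End 𝕜 V} (L : IsLefschetz e h)
    (L' : IsLefschetz e h') (k : ℕ) :
    Module.finrank 𝕜 (prim e h k) = Module.finrank 𝕜 (prim e h' k) := by
  have h1 := L.finrank_prim_add k
  have h2 := L'.finrank_prim_add k
  omega

theorem finrank_prim_eq_of_right {e e' h : Module.End 𝕜 V} (L : IsLefschetz e h)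
    (L' : IsLefschetz e' h) (k : ℕ) :
    Module.finrank 𝕜 (prim e h k) = Module.finrank 𝕜 (prim e' h k) := by
  have h1 := L.finrank_prim k
  have h2 := L'.finrank_prim k
  omega

/-- `G` acts on `g` and Lefschetz pairs in `g` with the same block sizes, one of them odd, are
conjugate under `G`. -/
structure HasConj (g : LieSubalgebra 𝕜 (Module.End 𝕜 V)) (G : Subgroup (V ≃ₗ[𝕜] V)) : Prop where
  conj_mem : ∀ a ∈ G, ∀ z ∈ g, a.conj z ∈ g
  exists_conj : ∀ e ∈ g, ∀ h ∈ g, ∀ e' ∈ g, ∀ h' ∈ g, IsLefschetz e h → IsLefschetz e' h' →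
    (∀ k, Module.finrank 𝕜 (prim e h k) = Module.finrank 𝕜 (prim e' h' k)) →
    (wt h 0 ≠ ⊥ ∨ Subsingleton V) → ∃ a ∈ G, a.conj e = e' ∧ a.conj h = h'

variable {g : LieSubalgebra 𝕜 (Module.End 𝕜 V)} {G : Subgroup (V ≃ₗ[𝕜] V)}

theorem orbit_eq_of_conj {x y : g} {a : V ≃ₗ[𝕜] V} (ha : a ∈ G)
    (hy : (y : Module.End 𝕜 V) = a.conj (x : Module.End 𝕜 V)) : orbit G x = orbit G y := by
  ext z
  constructor
  · rintro ⟨c, hc, hz⟩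
    refine ⟨c * a⁻¹, mul_mem hc (inv_mem ha), ?_⟩
    rw [hz, hy, mul_conj, inv_conj_conj]
  · rintro ⟨c, hc, hz⟩
    exact ⟨c * a, mul_mem hc ha, by rw [hz, hy, mul_conj]⟩

theorem dual_basis_separates {ι : Type w} {H : LieSubalgebra 𝕜 g}
    (Δ : Module.Basis ι 𝕜 (Module.Dual 𝕜 H)) {t : H} (ht : ∀ i, Δ i t = 0) : t = 0 := by
  rw [← Module.forall_dual_apply_eq_zero_iff 𝕜 t]
  intro φ
  have : Module.Dual.eval 𝕜 H t = 0 := Δ.ext fun i => ht i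
  exact LinearMap.congr_fun this φ

/-- For a friendly pair, half of each characteristic of an element of the first orbit is a
characteristic of some element of the second. -/
theorem HasConj.exists_half (hG : HasConj g G) {ι : Type w} {H : LieSubalgebra 𝕜 g}
    {Δ : Module.Basis ι 𝕜 (Module.Dual 𝕜 H)} {O O' : Set g} (hF : IsFriendlyPair G Δ O O')
    {e h f : g} (he : e ∈ O) (t : IsTriple e h f) :
    ∃ x y : g, O' = orbit G x ∧ IsTriple x ((2⁻¹ : 𝕜) • h) y := by
  obtain ⟨d, e₀, e₁, ⟨h₀, ⟨f₀, t₀⟩, s₀, ⟨a, ha, has⟩, hΔ⟩, ⟨h₁, ⟨f₁, t₁⟩, s₁, ⟨c, hc, hcs⟩, hΔ'⟩, rfl,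
    rfl⟩ := hF
  obtain ⟨r, hr, hre⟩ := he
  -- The two dominant elements have proportional values on a basis of the dual of `H`, so they are
  -- themselves proportional.
  have hs : s₀ = (2 : 𝕜) • s₁ := by
    rw [← sub_eq_zero]
    refine dual_basis_separates Δ fun i => ?_
    rw [map_sub, map_smul, hΔ, hΔ', smul_eq_mul]
    push_cast; ring
  have hs' : a.conj (h₀ : Module.End 𝕜 V) = (2 : 𝕜) • c.conj (h₁ : Module.End 𝕜 V) := by
    rw [← has, ← hcs, hs]; rfl
  set q : V ≃ₗ[𝕜] V := r * a⁻¹ * c with hq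
  have hqG : q ∈ G := mul_mem (mul_mem hr (inv_mem ha)) hc
  have hqh : q.conj (h₁ : Module.End 𝕜 V) = (2⁻¹ : 𝕜) • r.conj (h₀ : Module.End 𝕜 V) := by
    have h1 : c.conj (h₁ : Module.End 𝕜 V) = (2⁻¹ : 𝕜) • a.conj (h₀ : Module.End 𝕜 V) := by
      rw [hs', smul_smul, inv_mul_cancel₀ two_ne_zero, one_smul]
    rw [hq, mul_conj, mul_conj, h1, map_smul, inv_conj_conj, map_smul]
  have t₂ : IsTriple (e : Module.End 𝕜 V) (r.conj (h₀ : Module.End 𝕜 V)) (r.conj f₀) := by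
    rw [hre]; exact t₀.coe.conj r
  have t₃ := t₁.coe.conj q
  rw [hqh] at t₃
  -- Both `r.conj h₀` and `h` are characteristics of the same `e`, hence conjugate under `G`. Its
  -- hypothesis on weight `0` holds because half of `r.conj h₀` has integral weights.
  obtain ⟨z, hz, -, hzh⟩ := hG.exists_conj e e.2 _ (hG.conj_mem r hr _ h₀.2) e e.2 h h.2
    t₂.isLefschetz t.coe.isLefschetz
    (finrank_prim_eq_of_left t₂.isLefschetz t.coe.isLefschetz)
    (t₂.isLefschetz.wt_zero_ne_bot fun j => wt_eq_bot_of_odd t₃.isLefschetz.span)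
  have t₄ := t₃.conj z
  rw [map_smul, hzh, ← mul_conj, ← mul_conj] at t₄
  have hzq : z * q ∈ G := mul_mem hz hqG
  exact ⟨⟨_, hG.conj_mem _ hzq _ e₁.2⟩, ⟨_, hG.conj_mem _ hzq _ f₁.2⟩,
    orbit_eq_of_conj hzq rfl, IsTriple.of_coe t₄⟩

/-- The element `z` of `O'` and `x` are both Lefschetz for `h / 2`, so they have equal string
numbers. An element of `G` fixing `h / 2` carries `z` to `x`, and it also transports the third
member of the triple. -/
theorem HasConj.isHalfElement (hG : HasConj g G) {O' : Set g} {e h f x : g}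
    (t : IsTriple e h f) (hx : IsLefschetz (x : Module.End 𝕜 V) ((2⁻¹ : 𝕜) • (h : Module.End 𝕜 V)))
    (hO' : ∃ x y : g, O' = orbit G x ∧ IsTriple x ((2⁻¹ : 𝕜) • h) y) : IsHalfElement h O' x := by
  obtain ⟨z, y, rfl, t'⟩ := hO'
  have hmem : (2⁻¹ : 𝕜) • (h : Module.End 𝕜 V) ∈ g := g.smul_mem _ h.2
  have L' : IsLefschetz (z : Module.End 𝕜 V) ((2⁻¹ : 𝕜) • (h : Module.End 𝕜 V)) :=
    t'.coe.isLefschetz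
  obtain ⟨a, ha, haz, hah⟩ := hG.exists_conj z z.2 _ hmem x x.2 _ hmem L' hx
    (finrank_prim_eq_of_right L' hx) (by
      rw [wt_half]
      exact t.coe.isLefschetz.wt_zero_ne_bot fun j => wt_eq_bot_of_odd L'.span)
  have t'' : IsTriple (x : Module.End 𝕜 V) ((2⁻¹ : 𝕜) • (h : Module.End 𝕜 V)) (a.conj y) := by
    have := t'.coe.conj a
    change IsTriple _ (a.conj ((2⁻¹ : 𝕜) • (h : Module.End 𝕜 V))) _ at this
    rwa [haz, hah] at this
  refine ⟨⟨a, ha, haz.symm⟩, Subtype.ext (LinearMap.ext fun v => ?_),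
    ⟨a.conj y, hG.conj_mem a ha _ y.2⟩, IsTriple.of_coe t''⟩
  have h1 := hx.comm v
  simp only [LinearMap.smul_apply, map_smul] at h1
  rw [inv_smul_eq_iff₀ two_ne_zero, smul_add, smul_smul, mul_inv_cancel₀ two_ne_zero, one_smul] at h1
  change (h : Module.End 𝕜 V) ((x : Module.End 𝕜 V) v) - (x : Module.End 𝕜 V) ((h : Module.End 𝕜 V) v) =
    4 • (x : Module.End 𝕜 V) v
  rw [h1]
  module

end Friendly

/-! ### The conjugacy property for `sl`, `sp` and `so` -/

section Classical

variable {𝕜 : Type u} [Field 𝕜] [CharZero 𝕜] [IsAlgClosed 𝕜] {V : Type v} [AddCommGroup V]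
  [Module 𝕜 V] [FiniteDimensional 𝕜 V]

theorem mem_slLie {x : Module.End 𝕜 V} : x ∈ slLie 𝕜 V ↔ LinearMap.trace 𝕜 V x = 0 := Iff.rfl

theorem mem_skewAdjoint_iff {Φ : LinearMap.BilinForm 𝕜 V} {x : Module.End 𝕜 V} :
    x ∈ skewAdjointLieSubalgebra Φ ↔ IsSkew Φ x := by
  change x ∈ Φ.skewAdjointSubmodule ↔ _
  rw [LinearMap.mem_skewAdjointSubmodule]
  simp [LinearMap.IsSkewAdjoint, LinearMap.IsAdjointPair, IsSkew]

theorem hasConj_sl : HasConj (slLie 𝕜 V) (slGroup 𝕜 V) where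
  conj_mem a _ z hz := by
    rw [mem_slLie] at hz ⊢
    rw [LinearMap.trace_conj', hz]
  exists_conj _ _ _ _ _ _ _ _ L L' hd _ := L.exists_conj_sl L' hd

theorem conj_mem_skewAdjoint {Φ : LinearMap.BilinForm 𝕜 V} {a : V ≃ₗ[𝕜] V}
    (ha : a ∈ isometryGroup Φ) {z : Module.End 𝕜 V} (hz : z ∈ skewAdjointLieSubalgebra Φ) :
    a.conj z ∈ skewAdjointLieSubalgebra Φ := by
  rw [mem_skewAdjoint_iff] at hz ⊢
  intro u w
  have h1 : ∀ u, a.conj z (a u) = a (z u) := by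
    intro u
    simp [LinearEquiv.conj_apply]
  obtain ⟨u, rfl⟩ := a.surjective u
  obtain ⟨w, rfl⟩ := a.surjective w
  rw [h1, h1, ha, ha, hz]

theorem hasConj_sp {Φ : LinearMap.BilinForm 𝕜 V} (hΦ : Φ.IsAlt) (hnd : Φ.Nondegenerate) :
    HasConj (skewAdjointLieSubalgebra Φ) (isometryGroup Φ) where
  conj_mem _ ha _ hz := conj_mem_skewAdjoint ha hz
  exists_conj _ he _ hh _ he' _ hh' L L' hd _ :=
    L.exists_conj_isometry (Or.inr rfl) (fun a b => by linear_combination -(LinearMap.IsAlt.neg hΦ a b)) hnd.1 L'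
      (mem_skewAdjoint_iff.1 he) (mem_skewAdjoint_iff.1 hh) (mem_skewAdjoint_iff.1 he')
      (mem_skewAdjoint_iff.1 hh') hd

theorem hasConj_so {Φ : LinearMap.BilinForm 𝕜 V} (hΦ : Φ.IsSymm) (hnd : Φ.Nondegenerate) :
    HasConj (skewAdjointLieSubalgebra Φ) (isometryGroup Φ ⊓ slGroup 𝕜 V) where
  conj_mem _ ha _ hz := conj_mem_skewAdjoint ha.1 hz
  exists_conj _ he _ hh _ he' _ hh' L L' hd h0 :=
    L.exists_conj_special_isometry hΦ.eq hnd L'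
      (mem_skewAdjoint_iff.1 he) (mem_skewAdjoint_iff.1 hh) (mem_skewAdjoint_iff.1 he')
      (mem_skewAdjoint_iff.1 hh') hd h0

end Classical

/-! ### The constructed element on each summand -/

section Pieces

variable {𝕜 : Type u} [Field 𝕜] [CharZero 𝕜] {V : Type v} [AddCommGroup V] [Module 𝕜 V]

/-- The vectors of weight `k` in the image of `x ^ k` if `k` is nonnegative, and all vectors of
weight `k` if `k` is negative. -/
noncomputable def reached (x h : Module.End 𝕜 V) (k : ℤ) : Submodule 𝕜 V :=
  if 0 ≤ k then (wt h (-k)).map (x ^ k.toNat) else wt h k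

theorem mem_reached_of_neg {x h : Module.End 𝕜 V} {k : ℤ} (hk : k < 0) {v : V} (hv : v ∈ wt h k) :
    v ∈ ⨆ k : ℤ, reached x h k :=
  Submodule.mem_iSup_of_mem k (by rwa [reached, if_neg (by omega)])

theorem pow_mem_reached {x h : Module.End 𝕜 V} (n : ℕ) {v : V} (hv : v ∈ wt h (-n)) :
    (x ^ n) v ∈ ⨆ k : ℤ, reached x h k :=
  Submodule.mem_iSup_of_mem (n : ℤ) (by
    rw [reached, if_pos (by omega)]
    exact ⟨v, hv, by simp⟩)

/-- Each reached subspace lies in its weight space. Weight spaces are independent, so if the reached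
subspaces span `V` they equal the weight spaces; this is surjectivity, and the dimension bound makes
it bijectivity. -/
theorem isLefschetz_of_reached [FiniteDimensional 𝕜 V] {x h : Module.End 𝕜 V}
    (hx : ∀ v, h (x v) = x (h v) + (2 : 𝕜) • x v) (hr : ⨆ k : ℤ, reached x h k = ⊤)
    (hd : ∀ n : ℕ, Module.finrank 𝕜 (wt h (-n)) ≤ Module.finrank 𝕜 (wt h n)) :
    IsLefschetz x h := by
  have hle : ∀ k, reached x h k ≤ wt h k := by
    intro k
    rw [reached]
    split_ifs with hk
    · rintro _ ⟨v, hv, rfl⟩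
      exact mem_wt_of_eq (pow_mem_wt hx hv _) (by omega)
    · exact le_rfl
  have heq : ∀ k, wt h k ≤ reached x h k := by
    intro k v hv
    have hv' : v ∈ reached x h k ⊔ ⨆ (j : ℤ) (_ : j ≠ k), reached x h j := by
      rw [← iSup_split_single, hr]; trivial
    obtain ⟨a, ha, b, hb, rfl⟩ := Submodule.mem_sup.1 hv'
    have hb1 : b ∈ wt h k := by
      rw [← add_sub_cancel_left a b]
      exact Submodule.sub_mem _ hv (hle k ha)
    have hb2 : b ∈ ⨆ (j : ℤ) (_ : j ≠ k), wt h j := iSup₂_mono (fun j _ => hle j) hb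
    rw [Submodule.disjoint_def.1 (iSupIndep_wt h k) b hb1 hb2, add_zero]
    exact ha
  have hsurj : ∀ n : ℕ, ∀ v ∈ wt h n, ∃ u ∈ wt h (-n), (x ^ n) u = v := by
    intro n v hv
    have := heq n hv
    rw [reached, if_pos (by omega)] at this
    exact this
  exact ⟨hx, by rw [← top_le_iff, ← hr]; exact iSup_mono hle,
    fun n => inj_of_surj n (hd n) (hsurj n), hsurj⟩

/-- The vectors on which `x` commutes with `e` and has weight four for `h`, and which are reached. -/
noncomputable def good (e h x : Module.End 𝕜 V) : Submodule 𝕜 V :=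
  LinearMap.ker (e * x - x * e) ⊓ LinearMap.ker (h * x - x * h - (4 : 𝕜) • x) ⊓
    ⨆ k : ℤ, reached x ((2⁻¹ : 𝕜) • h) k

theorem mem_good {e h x : Module.End 𝕜 V} {v : V} : v ∈ good e h x ↔
    e (x v) = x (e v) ∧ h (x v) = x (h v) + (4 : 𝕜) • x v ∧
      v ∈ ⨆ k : ℤ, reached x ((2⁻¹ : 𝕜) • h) k := by
  rw [good, Submodule.mem_inf, Submodule.mem_inf, LinearMap.mem_ker, LinearMap.mem_ker, and_assoc]
  simp only [LinearMap.sub_apply, Module.End.mul_apply, LinearMap.smul_apply]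
  rw [sub_eq_zero, sub_eq_zero, sub_eq_iff_eq_add']

variable {e h x : Module.End 𝕜 V}

theorem jordanBlock_le_good (he : ∀ v, h (e v) = e (h v) + (2 : 𝕜) • e v) {l : ℕ}
    {A : Submodule 𝕜 V} (hA : IsJordanBlock e h (2 * l + 1) A) {s : 𝕜} (hs : s ≠ 0)
    (hx : ∀ a ∈ A, x a = s • e (e a)) : A ≤ good e h x := by
  obtain ⟨u, -, hspan, hu, hhu⟩ := hA
  have hmem : ∀ j, (e ^ j) u ∈ A := by
    intro j
    by_cases hj : j < 2 * l + 1
    · rw [← hspan]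
      exact Submodule.subset_span ⟨⟨j, hj⟩, rfl⟩
    · obtain ⟨c, rfl⟩ : ∃ c, j = c + (2 * l + 1) := ⟨j - (2 * l + 1), by omega⟩
      rw [pow_add, Module.End.mul_apply, hu, map_zero]
      exact Submodule.zero_mem _
  have hxe : ∀ j, x ((e ^ j) u) = s • (e ^ (j + 2)) u := by
    intro j
    rw [hx _ (hmem j), ← Module.End.mul_apply, ← Module.End.mul_apply, ← sq, ← pow_add,
      add_comm]
  have hxn : ∀ n j, (x ^ n) ((e ^ j) u) = s ^ n • (e ^ (j + 2 * n)) u := by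
    intro n
    induction n with
    | zero => simp
    | succ n ih =>
      intro j
      rw [pow_succ', Module.End.mul_apply, ih, map_smul, hxe, smul_smul, ← pow_succ]
      rfl
  have hwt : ∀ j : ℕ, (e ^ j) u ∈ wt h (2 * (j - l)) := by
    intro j
    have : u ∈ wt h (-(2 * l)) := by
      rw [mem_wt, hhu]; congr 1; push_cast; ring
    exact mem_wt_of_eq (pow_mem_wt he this j) (by ring)
  rw [← hspan, Submodule.span_le]
  rintro _ ⟨⟨j, hj⟩, rfl⟩
  refine mem_good.2 ⟨?_, ?_, ?_⟩
  · have hes : ∀ j, e ((e ^ j) u) = (e ^ (j + 1)) u := fun j => by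
      rw [pow_succ', Module.End.mul_apply]
    simp only
    rw [hxe, map_smul, hes, hes, hxe]
  · simp only
    rw [hxe, map_smul, mem_wt.1 (hwt (j + 2)), mem_wt.1 (hwt j), map_smul, hxe]
    push_cast
    module
  · simp only
    rcases lt_or_ge j l with hjl | hjl
    · exact mem_reached_of_neg (k := (j : ℤ) - l) (by omega) (by rw [wt_half]; exact hwt j)
    · have h1 : (e ^ (2 * l - j)) u ∈ wt ((2⁻¹ : 𝕜) • h) (-((j - l : ℕ) : ℤ)) := by
        rw [wt_half]
        exact mem_wt_of_eq (hwt _) (by push_cast [hjl, show j ≤ 2 * l by omega]; ring)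
      have h2 := pow_mem_reached (x := x) (j - l) h1
      rw [hxn, show 2 * l - j + 2 * (j - l) = j by omega] at h2
      exact (Submodule.smul_mem_iff _ (pow_ne_zero _ hs)).1 h2

theorem equalPiece_le_good {Φ : LinearMap.BilinForm 𝕜 V}
    (he : ∀ v, h (e v) = e (h v) + (2 : 𝕜) • e v) {U : Submodule 𝕜 V}
    (hU : IsEqualPiece Φ e h x U) : U ≤ good e h x := by
  obtain ⟨l, A, B, hA, hB, -, rfl, -, -, hxA, hxB⟩ := hU
  exact sup_le (jordanBlock_le_good he hA one_ne_zero (by simpa using hxA))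
    (jordanBlock_le_good he hB (neg_ne_zero.2 one_ne_zero) (by simpa using hxB))

theorem trivialPiece_le_good {U : Submodule 𝕜 V} (hU : IsTrivialPiece e h x U) :
    U ≤ good e h x := by
  intro u hu
  obtain ⟨h1, h2, h3⟩ := hU u hu
  refine mem_good.2 ⟨by simp [h1, h3], by simp [h2, h3], ?_⟩
  exact pow_mem_reached (x := x) 0 (v := u) (by rw [mem_wt]; simp [h2])

theorem mixedPiece_le_good {Φ : LinearMap.BilinForm 𝕜 V}
    (he : ∀ v, h (e v) = e (h v) + (2 : 𝕜) • e v) {U : Submodule 𝕜 V}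
    (hU : IsMixedPiece Φ e h x U) : U ≤ good e h x := by
  obtain ⟨m, v, w, hm, -, rfl, hv0, hw0, hev, hew, hhv, hhw, -, -, -, hxv, hxw⟩ := hU
  have hwv : ∀ i : ℕ, 1 ≤ i → v i ∈ wt h (2 * (i - 1 - 2 * m)) := by
    intro i hi
    induction i, hi using Nat.le_induction with
    | base => rw [mem_wt, hhv]; congr 1; push_cast; ring
    | succ i hi ih =>
      rw [← hev i hi]
      exact mem_wt_of_eq (mem_wt_add_two he ih) (by push_cast; ring)
  have hww : ∀ i : ℕ, 2 ≤ i → w i ∈ wt h (2 * (i - 1 - 2 * m)) := by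
    intro i hi
    induction i, hi using Nat.le_induction with
    | base => rw [mem_wt, hhw]; congr 1; push_cast; ring
    | succ i hi ih =>
      rw [← hew i hi]
      exact mem_wt_of_eq (mem_wt_add_two he ih) (by push_cast; ring)
  have hx2v : ∀ t j, 1 ≤ j → (x ^ (2 * t)) (v j) = v (j + 4 * t) := by
    intro t
    induction t with
    | zero => simp
    | succ t ih =>
      intro j hj
      rw [mul_add, add_comm, pow_add, Module.End.mul_apply, ih j hj, mul_one, pow_two,
        Module.End.mul_apply, hxv _ (by omega), map_neg, hxw _ (by omega), neg_neg]
      rfl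
  have hx2w : ∀ t j, 2 ≤ j → (x ^ (2 * t)) (w j) = w (j + 4 * t) := by
    intro t
    induction t with
    | zero => simp
    | succ t ih =>
      intro j hj
      rw [mul_add, add_comm, pow_add, Module.End.mul_apply, ih j hj, mul_one, pow_two,
        Module.End.mul_apply, hxw _ (by omega), map_neg, hxv _ (by omega), neg_neg]
      rfl
  have hwv' : ∀ i : ℕ, 1 ≤ i → v i ∈ wt ((2⁻¹ : 𝕜) • h) (i - 1 - 2 * m) := fun i hi => by
    rw [wt_half]; exact hwv i hi
  have hww' : ∀ i : ℕ, 2 ≤ i → w i ∈ wt ((2⁻¹ : 𝕜) • h) (i - 1 - 2 * m) := fun i hi => by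
    rw [wt_half]; exact hww i hi
  rw [Submodule.span_le, Set.union_subset_iff]
  constructor
  · rintro _ ⟨i, ⟨hi1, hi2⟩, rfl⟩
    refine mem_good.2 ⟨?_, ?_, ?_⟩
    · rw [hxv i hi1, map_neg, hew _ (by omega), hev i hi1, hxv _ (by omega)]
    · rw [hxv i hi1, map_neg, mem_wt.1 (hww _ (by omega)), mem_wt.1 (hwv i hi1), map_smul, hxv i hi1]
      push_cast
      module
    · rcases lt_or_ge i (2 * m + 1) with hlt | hge
      · exact mem_reached_of_neg (k := (i : ℤ) - 1 - 2 * m) (by omega) (hwv' i hi1)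
      · obtain ⟨n, rfl⟩ := Nat.exists_eq_add_of_le hge
        -- The index at distance `n` above the centre `2m + 1` is reached by `x ^ n` from distance
        -- `n` below it, within the same string for even `n` and from the other string for odd `n`.
        rcases Nat.even_or_odd' n with ⟨t, rfl | rfl⟩
        · have := pow_mem_reached (x := x) (2 * t) (v := v (2 * m + 1 - 2 * t))
            (mem_wt_of_eq (hwv' _ (by omega)) (by omega))
          rw [hx2v _ _ (by omega), show 2 * m + 1 - 2 * t + 4 * t = 2 * m + 1 + 2 * t by omega] at this
          exact this
        · have := pow_mem_reached (x := x) (2 * t + 1) (v := w (2 * m - 2 * t))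
            (mem_wt_of_eq (hww' _ (by omega)) (by omega))
          rw [pow_succ', Module.End.mul_apply, hx2w _ _ (by omega), hxw _ (by omega),
            show 2 * m - 2 * t + 4 * t + 2 = 2 * m + 1 + (2 * t + 1) by omega] at this
          simpa using this
  · rintro _ ⟨i, ⟨hi1, hi2⟩, rfl⟩
    refine mem_good.2 ⟨?_, ?_, ?_⟩
    · rw [hxw i hi1, map_neg, hev _ (by omega), hew i hi1, hxw _ (by omega)]
    · rw [hxw i hi1, map_neg, mem_wt.1 (hwv _ (by omega)), mem_wt.1 (hww i hi1), map_smul, hxw i hi1]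
      push_cast
      module
    · rcases lt_or_ge i (2 * m + 1) with hlt | hge
      · exact mem_reached_of_neg (k := (i : ℤ) - 1 - 2 * m) (by omega) (hww' i hi1)
      · obtain ⟨n, rfl⟩ := Nat.exists_eq_add_of_le hge
        rcases Nat.even_or_odd' n with ⟨t, rfl | rfl⟩
        · have := pow_mem_reached (x := x) (2 * t) (v := w (2 * m + 1 - 2 * t))
            (mem_wt_of_eq (hww' _ (by omega)) (by omega))
          rw [hx2w _ _ (by omega), show 2 * m + 1 - 2 * t + 4 * t = 2 * m + 1 + 2 * t by omega] at this
          exact this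
        · have := pow_mem_reached (x := x) (2 * t + 1) (v := v (2 * m - 2 * t))
            (mem_wt_of_eq (hwv' _ (by omega)) (by omega))
          rw [pow_succ', Module.End.mul_apply, hx2v _ _ (by omega), hxv _ (by omega),
            show 2 * m - 2 * t + 4 * t + 2 = 2 * m + 1 + (2 * t + 1) by omega] at this
          simpa using this

theorem SpConstruction.soConstruction {Φ : LinearMap.BilinForm 𝕜 V}
    (hx : SpConstruction Φ e h x) : SoConstruction Φ e h x := by
  obtain ⟨k, U, hU, hΦ, hP⟩ := hx
  exact ⟨k, U, hU, hΦ, fun j => Or.inl (hP j)⟩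

theorem SoConstruction.good_eq_top {Φ : LinearMap.BilinForm 𝕜 V}
    (he : ∀ v, h (e v) = e (h v) + (2 : 𝕜) • e v) (hx : SoConstruction Φ e h x) :
    good e h x = ⊤ := by
  obtain ⟨k, U, hU, -, hP⟩ := hx
  rw [← top_le_iff, ← hU.submodule_iSup_eq_top]
  refine iSup_le fun j => ?_
  rcases hP j with h1 | h1 | h1
  · exact equalPiece_le_good he h1
  · exact mixedPiece_le_good he h1
  · exact trivialPiece_le_good h1

variable [FiniteDimensional 𝕜 V]

theorem SoConstruction.isLefschetz {Φ : LinearMap.BilinForm 𝕜 V} (L : IsLefschetz e h)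
    (hx : SoConstruction Φ e h x) : IsLefschetz x ((2⁻¹ : 𝕜) • h) := by
  have hgood := hx.good_eq_top L.comm
  refine isLefschetz_of_reached ?_ ?_ ?_
  · intro v
    have hv : v ∈ good e h x := by rw [hgood]; trivial
    have := (mem_good.1 hv).2.1
    simp only [LinearMap.smul_apply, map_smul, this, smul_add, smul_smul]
    norm_num
  · rw [← top_le_iff, ← hgood]
    exact inf_le_right
  · intro n
    have := finrank_wt_le_of_inj L.comm (2 * n) (L.inj (2 * n))
    rw [wt_half, wt_half]
    rwa [show -((2 * n : ℕ) : ℤ) = 2 * -n by push_cast; ring,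
      show ((2 * n : ℕ) : ℤ) = 2 * n by push_cast; ring] at this

theorem SoConstruction.commute {Φ : LinearMap.BilinForm 𝕜 V} (L : IsLefschetz e h)
    (hx : SoConstruction Φ e h x) (v : V) : e (x v) = x (e v) := by
  have hv : v ∈ good e h x := by rw [hx.good_eq_top L.comm]; trivial
  exact (mem_good.1 hv).1

/-- Weight `k` of `h / 2` is weight `2k` of `h`, and `(e ^ 2) ^ k = e ^ (2k)`. -/
theorem IsLefschetz.sq (L : IsLefschetz e h) (hs : ⨆ k : ℤ, wt ((2⁻¹ : 𝕜) • h) k = ⊤) :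
    IsLefschetz (e ^ 2) ((2⁻¹ : 𝕜) • h) where
  comm v := by
    simp only [pow_two, Module.End.mul_apply, LinearMap.smul_apply, L.comm, map_add, map_smul]
    module
  span := hs
  inj k v hv h0 := by
    rw [wt_half] at hv
    exact L.inj (2 * k) v (mem_wt_of_eq hv (by push_cast; ring)) (by rwa [pow_mul])
  surj k v hv := by
    rw [wt_half] at hv
    obtain ⟨u, hu, rfl⟩ := L.surj (2 * k) v (mem_wt_of_eq hv (by push_cast; ring))
    refine ⟨u, ?_, by rw [pow_mul]⟩
    rw [wt_half]
    exact mem_wt_of_eq hu (by push_cast; ring)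

end Pieces

/-! ### Skew-adjointness of the constructed element -/

section Skewness

variable {𝕜 : Type u} [Field 𝕜] [CharZero 𝕜] {V : Type v} [AddCommGroup V] [Module 𝕜 V]
  {Φ : LinearMap.BilinForm 𝕜 V} {e h x : Module.End 𝕜 V} {U : Submodule 𝕜 V}

theorem jordanBlock_stable {r : ℕ} {A : Submodule 𝕜 V} (hA : IsJordanBlock e h r A) :
    ∀ a ∈ A, e a ∈ A := by
  obtain ⟨u, -, rfl, hu, -⟩ := hA
  intro a ha
  have : Submodule.span 𝕜 (Set.range fun i : Fin r => (e ^ (i : ℕ)) u) ≤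
      (Submodule.span 𝕜 (Set.range fun i : Fin r => (e ^ (i : ℕ)) u)).comap e := by
    rw [Submodule.span_le]
    rintro _ ⟨i, rfl⟩
    change e ((e ^ (i : ℕ)) u) ∈ Submodule.span 𝕜 (Set.range fun i : Fin r => (e ^ (i : ℕ)) u)
    rw [← Module.End.mul_apply, ← pow_succ']
    by_cases hi : (i : ℕ) + 1 < r
    · exact Submodule.subset_span ⟨⟨i + 1, hi⟩, rfl⟩
    · rw [show (i : ℕ) + 1 = r by omega, hu]
      exact Submodule.zero_mem _
  exact this ha

/-- The square of `e` is self-adjoint. As `A` and `B` are isotropic, only pairings between them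
survive, and there the opposite signs of `x` turn self-adjoint into skew-adjoint. -/
theorem equalPiece_skew (he : IsSkew Φ e) (hU : IsEqualPiece Φ e h x U) :
    (∀ u ∈ U, x u ∈ U) ∧ ∀ u ∈ U, ∀ w ∈ U, Φ (x u) w = -Φ u (x w) := by
  obtain ⟨l, A, B, hA, hB, -, rfl, hAA, hBB, hxA, hxB⟩ := hU
  have hAe : ∀ a ∈ A, e (e a) ∈ A := fun a ha => jordanBlock_stable hA _ (jordanBlock_stable hA _ ha)
  have hBe : ∀ a ∈ B, e (e a) ∈ B := fun a ha => jordanBlock_stable hB _ (jordanBlock_stable hB _ ha)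
  constructor
  · intro u hu
    obtain ⟨a, ha, b, hb, rfl⟩ := Submodule.mem_sup.1 hu
    rw [map_add, hxA a ha, hxB b hb]
    exact Submodule.add_mem_sup (hAe a ha) (Submodule.neg_mem _ (hBe b hb))
  · intro u hu w hw
    obtain ⟨a, ha, b, hb, rfl⟩ := Submodule.mem_sup.1 hu
    obtain ⟨c, hc, d, hd, rfl⟩ := Submodule.mem_sup.1 hw
    simp only [map_add, hxA a ha, hxB b hb, hxA c hc, hxB d hd, LinearMap.add_apply, map_neg,
      LinearMap.neg_apply]
    rw [hAA _ (hAe a ha) c hc, hBB _ (hBe b hb) d hd, hAA a ha _ (hAe c hc), hBB b hb _ (hBe d hd),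
      he (e a) d, he a (e d), he (e b) c, he b (e c)]
    ring

theorem trivialPiece_skew (hU : IsTrivialPiece e h x U) :
    (∀ u ∈ U, x u ∈ U) ∧ ∀ u ∈ U, ∀ w ∈ U, Φ (x u) w = -Φ u (x w) := by
  constructor
  · intro u hu
    rw [(hU u hu).2.2]
    exact Submodule.zero_mem _
  · intro u hu w hw
    rw [(hU u hu).2.2, (hU w hw).2.2]
    simp

theorem span_skew {S : Set V} (hS : ∀ u ∈ S, x u ∈ Submodule.span 𝕜 S)
    (hS' : ∀ u ∈ S, ∀ w ∈ S, Φ (x u) w = -Φ u (x w)) :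
    (∀ u ∈ Submodule.span 𝕜 S, x u ∈ Submodule.span 𝕜 S) ∧
      ∀ u ∈ Submodule.span 𝕜 S, ∀ w ∈ Submodule.span 𝕜 S, Φ (x u) w = -Φ u (x w) := by
  constructor
  · intro u hu
    have : Submodule.span 𝕜 S ≤ (Submodule.span 𝕜 S).comap x := Submodule.span_le.2 hS
    exact this hu
  · intro u hu w hw
    induction hu, hw using Submodule.span_induction₂ with
    | mem_mem u w hu hw => exact hS' u hu w hw
    | zero_left => simp
    | zero_right => simp
    | add_left u v w _ _ _ h1 h2 =>
      simp only [map_add, LinearMap.add_apply, h1, h2]; ring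
    | add_right u v w _ _ _ h1 h2 =>
      simp only [map_add, h1, h2]; ring
    | smul_left r u v _ _ h1 => simp [h1]
    | smul_right r u v _ _ h1 => simp [h1]

/-- Since `x` interchanges the two orthogonal strings, only mixed arguments matter; there skewness
is the opposition of the signs `(-1) ^ (i + 1)` and `(-1) ^ i` in the two Gram matrices. -/
theorem mixedPiece_skew (hΦ : ∀ a b, Φ a b = Φ b a) (hU : IsMixedPiece Φ e h x U) :
    (∀ u ∈ U, x u ∈ U) ∧ ∀ u ∈ U, ∀ w ∈ U, Φ (x u) w = -Φ u (x w) := by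
  obtain ⟨m, v, w, hm, -, rfl, hv0, hw0, -, -, -, -, hvv, hww, hvw, hxv, hxw⟩ := hU
  have hvv' : ∀ i j, 1 ≤ i → 1 ≤ j →
      Φ (v i) (v j) = if i + j = 4 * m + 2 then (-1) ^ (i + 1) else 0 := by
    intro i j hi hj
    by_cases hi' : i ≤ 4 * m + 1
    · by_cases hj' : j ≤ 4 * m + 1
      · exact hvv i ⟨hi, hi'⟩ j ⟨hj, hj'⟩
      · rw [hv0 j (by omega), map_zero, if_neg (by omega)]
    · rw [hv0 i (by omega), map_zero, LinearMap.zero_apply, if_neg (by omega)]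
  have hww' : ∀ i j, 2 ≤ i → 2 ≤ j →
      Φ (w i) (w j) = if i + j = 4 * m + 2 then (-1) ^ i else 0 := by
    intro i j hi hj
    by_cases hi' : i ≤ 4 * m
    · by_cases hj' : j ≤ 4 * m
      · exact hww i ⟨hi, hi'⟩ j ⟨hj, hj'⟩
      · rw [hw0 j (by omega), map_zero, if_neg (by omega)]
    · rw [hw0 i (by omega), map_zero, LinearMap.zero_apply, if_neg (by omega)]
  have hvw' : ∀ i j, 1 ≤ i → 2 ≤ j → Φ (v i) (w j) = 0 := by
    intro i j hi hj
    by_cases hi' : i ≤ 4 * m + 1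
    · by_cases hj' : j ≤ 4 * m
      · exact hvw i ⟨hi, hi'⟩ j ⟨hj, hj'⟩
      · rw [hw0 j (by omega), map_zero]
    · rw [hv0 i (by omega), map_zero, LinearMap.zero_apply]
  apply span_skew
  · rintro _ (⟨i, ⟨hi1, hi2⟩, rfl⟩ | ⟨i, ⟨hi1, hi2⟩, rfl⟩)
    · rw [hxv i hi1]
      refine Submodule.neg_mem _ ?_
      by_cases hi : i + 2 ≤ 4 * m
      · exact Submodule.subset_span (Or.inr ⟨i + 2, ⟨by omega, hi⟩, rfl⟩)
      · rw [hw0 _ (by omega)]; exact Submodule.zero_mem _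
    · rw [hxw i hi1]
      refine Submodule.neg_mem _ ?_
      by_cases hi : i + 2 ≤ 4 * m + 1
      · exact Submodule.subset_span (Or.inl ⟨i + 2, ⟨by omega, hi⟩, rfl⟩)
      · rw [hv0 _ (by omega)]; exact Submodule.zero_mem _
  · have hmix : ∀ i j, 1 ≤ i → 2 ≤ j → Φ (x (v i)) (w j) = -Φ (v i) (x (w j)) := by
      intro i j hi hj
      rw [hxv i hi, hxw j hj, map_neg, map_neg, LinearMap.neg_apply, neg_neg,
        hww' _ _ (by omega) hj, hvv' _ _ hi (by omega)]
      by_cases hij : i + 2 + j = 4 * m + 2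
      · rw [if_pos hij, if_pos (by omega), pow_add, pow_succ]; ring
      · rw [if_neg hij, if_neg (by omega), neg_zero]
    rintro _ (⟨i, ⟨hi1, hi2⟩, rfl⟩ | ⟨i, ⟨hi1, hi2⟩, rfl⟩) _ (⟨j, ⟨hj1, hj2⟩, rfl⟩ | ⟨j, ⟨hj1, hj2⟩, rfl⟩)
    · rw [hxv i hi1, hxv j hj1, map_neg, map_neg, LinearMap.neg_apply, hvw' _ _ hi1 (by omega),
        hΦ, hvw' _ _ hj1 (by omega)]
      simp
    · exact hmix i j hi1 hj1
    · rw [hΦ, hΦ (w i), hmix j i hj1 hi1, neg_neg]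
    · rw [hxw i hi1, hxw j hj1, map_neg, map_neg, LinearMap.neg_apply, hvw' _ _ (by omega) hj1,
        hΦ, hvw' _ _ (by omega) hi1]
      simp

theorem IsOrthogonalSum.isSkew {P : Submodule 𝕜 V → Prop} (hP : IsOrthogonalSum Φ P)
    (hx : ∀ U, P U → (∀ u ∈ U, x u ∈ U) ∧ ∀ u ∈ U, ∀ w ∈ U, Φ (x u) w = -Φ u (x w)) :
    IsSkew Φ x := by
  obtain ⟨k, U, hU, hΦ, hP⟩ := hP
  intro a b
  have ha : a ∈ ⨆ j, U j := by rw [hU.submodule_iSup_eq_top]; trivial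
  have hb : b ∈ ⨆ j, U j := by rw [hU.submodule_iSup_eq_top]; trivial
  induction ha using Submodule.iSup_induction' with
  | mem i a hai =>
    induction hb using Submodule.iSup_induction' with
    | mem j b hbj =>
      by_cases hij : i = j
      · subst hij
        exact (hx _ (hP i)).2 a hai b hbj
      · rw [hΦ i j hij _ ((hx _ (hP i)).1 a hai) b hbj, hΦ i j hij a hai _ ((hx _ (hP j)).1 b hbj),
          neg_zero]
    | zero => simp
    | add y z _ _ hy hz => rw [map_add, map_add, map_add, hy, hz]; ring
  | zero => simp
  | add y z _ _ hy hz =>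
    rw [map_add, map_add, map_add, LinearMap.add_apply, LinearMap.add_apply, hy, hz]; ring

theorem SoConstruction.isSkew (hΦ : ∀ a b, Φ a b = Φ b a) (he : IsSkew Φ e)
    (hx : SoConstruction Φ e h x) : IsSkew Φ x :=
  IsOrthogonalSum.isSkew hx fun U hU => by
    rcases hU with h1 | h1 | h1
    · exact equalPiece_skew he h1
    · exact mixedPiece_skew hΦ h1
    · exact trivialPiece_skew h1

theorem SpConstruction.isSkew (he : IsSkew Φ e) (hx : SpConstruction Φ e h x) : IsSkew Φ x :=
  IsOrthogonalSum.isSkew hx fun _ hU => equalPiece_skew he hU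

end Skewness

/-! ### Grouping Jordan strings into summands -/

section Existence

variable {𝕜 : Type u} [Field 𝕜] [CharZero 𝕜] {V : Type v} [AddCommGroup V] [Module 𝕜 V]

/-- A partition of a basis into blocks that are pairwise orthogonal gives an orthogonal sum. -/
theorem isOrthogonalSum_of_partition {Φ : LinearMap.BilinForm 𝕜 V} {X J : Type*} [Finite X]
    (b : Module.Basis X 𝕜 V) (π : X → J) (hΦ : ∀ α β, π α ≠ π β → Φ (b α) (b β) = 0)
    {P : Submodule 𝕜 V → Prop} (hP : ∀ α, P (Submodule.span 𝕜 (b '' {β | π β = π α}))) :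
    IsOrthogonalSum Φ P := by
  classical
  obtain ⟨n, ⟨φ⟩⟩ := Finite.exists_equiv_fin (Set.range π)
  set U : Fin n → Submodule 𝕜 V := fun i =>
    Submodule.span 𝕜 (b '' {β | π β = (φ.symm i : J)}) with hU
  refine ⟨n, U, ?_, ?_, ?_⟩
  · refine DirectSum.isInternal_submodule_of_iSupIndep_of_iSup_eq_top ?_ ?_
    · intro i
      have hle : (⨆ (j) (_ : j ≠ i), U j) ≤
          Submodule.span 𝕜 (b '' {β | π β ≠ (φ.symm i : J)}) := by
        refine iSup₂_le fun j hj => Submodule.span_mono (Set.image_mono fun β hβ => ?_)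
        rw [Set.mem_ofPred_eq] at hβ ⊢
        rw [hβ]
        exact fun h => hj (φ.symm.injective (Subtype.ext h))
      refine Disjoint.mono_right hle ?_
      exact b.linearIndependent.disjoint_span_image
        (Set.disjoint_left.2 fun β hβ hβ' => hβ' hβ)
    · rw [← top_le_iff, ← b.span_eq, Submodule.span_le]
      rintro _ ⟨α, rfl⟩
      refine Submodule.mem_iSup_of_mem (φ ⟨π α, α, rfl⟩) (Submodule.subset_span ⟨α, ?_, rfl⟩)
      simp
  · intro i j hij a ha c hc
    induction ha, hc using Submodule.span_induction₂ with
    | mem_mem x y hx hy =>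
      obtain ⟨α, hα, rfl⟩ := hx
      obtain ⟨β, hβ, rfl⟩ := hy
      rw [Set.mem_ofPred_eq] at hα hβ
      refine hΦ α β ?_
      rw [hα, hβ]
      exact fun h => hij (φ.symm.injective (Subtype.ext h))
    | zero_left => simp
    | zero_right => simp
    | add_left u v w _ _ _ h1 h2 => simp [h1, h2]
    | add_right u v w _ _ _ h1 h2 => simp [h1, h2]
    | smul_left r u v _ _ h1 => simp [h1]
    | smul_right r u v _ _ h1 => simp [h1]
  · intro i
    obtain ⟨α, hα⟩ := (φ.symm i).2
    have := hP α
    rw [hα] at this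
    exact this

/-- A basis of Jordan strings for which the form pairs the strings `p` and `d k - 1 - p` of length
`k + 1`. -/
structure IsFormBasis (Φ : LinearMap.BilinForm 𝕜 V) (e h : Module.End 𝕜 V) {d : ℕ → ℕ}
    (b : Module.Basis (Σ k, Fin (d k) × Fin (k + 1)) 𝕜 V) (δ : ℕ → 𝕜) : Prop where
  e_apply : ∀ k p (i : Fin (k + 1)), e (b ⟨k, p, i⟩) =
    if hi : (i : ℕ) + 1 < k + 1 then b ⟨k, p, ⟨i + 1, hi⟩⟩ else 0
  mem_wt : ∀ k p (i : Fin (k + 1)), b ⟨k, p, i⟩ ∈ wt h (-k + 2 * (i : ℕ))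
  form : ∀ k p (i : Fin (k + 1)) l q (j : Fin (l + 1)), Φ (b ⟨k, p, i⟩) (b ⟨l, q, j⟩) =
    if k = l ∧ (p : ℕ) + q + 1 = d k ∧ (i : ℕ) + j = k then
      (-1) ^ (i : ℕ) * (if (p : ℕ) ≤ q then 1 else δ k) else 0

variable {d : ℕ → ℕ}

/-- The basis vectors with natural indices, extended by zero. -/
noncomputable def stringVec (b : Module.Basis (Σ k, Fin (d k) × Fin (k + 1)) 𝕜 V) (k p i : ℕ) : V :=
  if h : p < d k ∧ i < k + 1 then b ⟨k, ⟨p, h.1⟩, ⟨i, h.2⟩⟩ else 0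

/-- The image of `stringVec b k p i` under the element `e^⟨2⟩`. -/
noncomputable def halfVec (b : Module.Basis (Σ k, Fin (d k) × Fin (k + 1)) 𝕜 V) (k p i : ℕ) : V :=
  -- The partner of string `p` is `d k - 1 - p`. The first half of the strings gets the sign `+`,
  -- the second half `-`; a string that is its own partner is treated by the remaining cases.
  if 2 * p + 1 < d k then stringVec b k p (i + 2)
  else if d k < 2 * p + 1 then -stringVec b k p (i + 2)
  else if k = 0 then 0
  -- The shifts `i + 1` and `i + 3` both raise the weight by four, since the target string starts
  -- two higher, respectively two lower, than the source.
  else if k % 4 = 0 then -stringVec b (k - 2) (d (k - 2) / 2) (i + 1)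
  else -stringVec b (k + 2) (d (k + 2) / 2) (i + 3)

/-- The element `e^⟨2⟩` attached to a basis of Jordan strings. -/
noncomputable def halfEnd (b : Module.Basis (Σ k, Fin (d k) × Fin (k + 1)) 𝕜 V) :
    Module.End 𝕜 V :=
  b.constr 𝕜 fun α => halfVec b α.1 α.2.1 α.2.2

/-- The label of the orthogonal summand that contains a given basis vector. -/
def pieceLabel (d : ℕ → ℕ) (k p : ℕ) : ℕ × ℕ × ℕ :=
  -- For self-paired strings, `k = 4m` and `k = 4m - 2` share the label `m`, and `k = 0` gets `0`.
  -- All other strings share a label exactly with their partner.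
  if 2 * p + 1 = d k then (0, (k + 2) / 4, 0) else (1, k, min p (d k - 1 - p))

section

variable {b : Module.Basis (Σ k, Fin (d k) × Fin (k + 1)) 𝕜 V}

theorem stringVec_of_lt {k p i : ℕ} (hp : p < d k) (hi : i < k + 1) :
    stringVec b k p i = b ⟨k, ⟨p, hp⟩, ⟨i, hi⟩⟩ := dif_pos ⟨hp, hi⟩

theorem stringVec_of_le {k p i : ℕ} (hi : k < i) : stringVec b k p i = 0 :=
  dif_neg fun h => by omega

theorem halfEnd_stringVec {k p i : ℕ} (hp : p < d k) :
    halfEnd b (stringVec b k p i) = halfVec b k p i := by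
  by_cases hi : i < k + 1
  · rw [stringVec_of_lt hp hi, halfEnd, Module.Basis.constr_basis]
  · rw [stringVec_of_le (by omega), map_zero, halfVec]
    split_ifs with h1 h2 h3 h4
    · rw [stringVec_of_le (by omega)]
    · rw [stringVec_of_le (by omega), neg_zero]
    · rfl
    · rw [stringVec_of_le (by omega), neg_zero]
    · rw [stringVec_of_le (by omega), neg_zero]

variable {Φ : LinearMap.BilinForm 𝕜 V} {e h : Module.End 𝕜 V} {δ : ℕ → 𝕜}

namespace IsFormBasis

variable (hb : IsFormBasis Φ e h b δ)

include hb

theorem e_stringVec (k p i : ℕ) : e (stringVec b k p i) = stringVec b k p (i + 1) := by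
  by_cases hp : p < d k
  · by_cases hi : i < k + 1
    · rw [stringVec_of_lt hp hi, hb.e_apply]
      split_ifs with h1
      · rw [stringVec_of_lt hp h1]
      · rw [stringVec_of_le (by simpa using h1)]
    · rw [stringVec_of_le (by omega), stringVec_of_le (by omega), map_zero]
  · rw [stringVec, stringVec, dif_neg (fun h => hp h.1), dif_neg (fun h => hp h.1), map_zero]

theorem e_pow_stringVec (k p i : ℕ) : (e ^ i) (stringVec b k p 0) = stringVec b k p i := by
  induction i with
  | zero => simp
  | succ i ih => rw [pow_succ', Module.End.mul_apply, ih, hb.e_stringVec]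

theorem h_stringVec (k p i : ℕ) :
    h (stringVec b k p i) = (-(k : 𝕜) + 2 * i) • stringVec b k p i := by
  by_cases hp : p < d k ∧ i < k + 1
  · rw [stringVec_of_lt hp.1 hp.2, FriendlyPairs.mem_wt.1 (hb.mem_wt _ _ _)]
    push_cast; rfl
  · rw [stringVec, dif_neg hp, map_zero, smul_zero]

theorem form_stringVec {k p l q : ℕ} (i j : ℕ) (hp : p < d k) (hq : q < d l) :
    Φ (stringVec b k p i) (stringVec b l q j) = if k = l ∧ p + q + 1 = d k ∧ i + j = k then
      (-1) ^ i * (if p ≤ q then 1 else δ k) else 0 := by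
  by_cases hi : i < k + 1
  · by_cases hj : j < l + 1
    · rw [stringVec_of_lt hp hi, stringVec_of_lt hq hj, hb.form]
    · rw [stringVec_of_le (i := j) (by omega), map_zero, if_neg (by omega)]
  · rw [stringVec_of_le (i := i) (by omega), map_zero, LinearMap.zero_apply, if_neg (by omega)]

theorem span_string {k p : ℕ} (hp : p < d k) :
    Submodule.span 𝕜 (Set.range fun i : Fin (k + 1) => (e ^ (i : ℕ)) (stringVec b k p 0)) =
      Submodule.span 𝕜 (b '' {β | β.1 = k ∧ (β.2.1 : ℕ) = p}) := by
  congr 1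
  ext z
  constructor
  · rintro ⟨i, rfl⟩
    exact ⟨⟨k, ⟨p, hp⟩, i⟩, ⟨rfl, rfl⟩, by
      simp only
      rw [hb.e_pow_stringVec, stringVec_of_lt hp i.2]⟩
  · rintro ⟨⟨k', p', i⟩, ⟨h1, h2⟩, rfl⟩
    dsimp at h1
    subst h1
    dsimp at h2
    subst h2
    exact ⟨i, by
      simp only
      rw [hb.e_pow_stringVec, stringVec_of_lt hp i.2]⟩

theorem isJordanBlock {l p : ℕ} (hp : p < d (2 * l)) :
    IsJordanBlock e h (2 * l + 1)
      (Submodule.span 𝕜 (b '' {β | β.1 = 2 * l ∧ (β.2.1 : ℕ) = p})) := by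
  refine ⟨stringVec b (2 * l) p 0, ?_, hb.span_string hp, ?_, ?_⟩
  · have : (fun i : Fin (2 * l + 1) => (e ^ (i : ℕ)) (stringVec b (2 * l) p 0)) =
        b ∘ fun i : Fin (2 * l + 1) => ⟨2 * l, ⟨p, hp⟩, i⟩ := by
      funext i
      rw [hb.e_pow_stringVec, stringVec_of_lt hp i.2]
      rfl
    rw [this]
    exact b.linearIndependent.comp _ fun i j hij => by simpa using hij
  · rw [hb.e_pow_stringVec, stringVec_of_le (by omega)]
  · rw [hb.h_stringVec]
    congr 1
    push_cast; ring

/-- A string pairs only with its partner, and the inequality says that it is not its own partner. -/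
theorem isotropic {k p : ℕ} (hne : 2 * p + 1 ≠ d k) :
    ∀ a ∈ Submodule.span 𝕜 (b '' {β | β.1 = k ∧ (β.2.1 : ℕ) = p}),
      ∀ c ∈ Submodule.span 𝕜 (b '' {β | β.1 = k ∧ (β.2.1 : ℕ) = p}), Φ a c = 0 := by
  intro a ha c hc
  induction ha, hc using Submodule.span_induction₂ with
  | mem_mem x y hx hy =>
    obtain ⟨⟨k', p', i⟩, ⟨h1, h2⟩, rfl⟩ := hx
    obtain ⟨⟨l', q', j⟩, ⟨h3, h4⟩, rfl⟩ := hy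
    dsimp only at h1 h3
    subst h1
    subst h3
    dsimp only at h2 h4
    rw [hb.form, if_neg (by omega)]
  | zero_left => simp
  | zero_right => simp
  | add_left u v w _ _ _ h1 h2 => simp [h1, h2]
  | add_right u v w _ _ _ h1 h2 => simp [h1, h2]
  | smul_left r u v _ _ h1 => simp [h1]
  | smul_right r u v _ _ h1 => simp [h1]

theorem halfEnd_on_string {k p : ℕ} {s : 𝕜}
    (hs : ∀ i, halfVec b k p i = s • stringVec b k p (i + 2)) :
    ∀ a ∈ Submodule.span 𝕜 (b '' {β | β.1 = k ∧ (β.2.1 : ℕ) = p}),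
      halfEnd b a = s • e (e a) := by
  intro a ha
  induction ha using Submodule.span_induction with
  | mem x hx =>
    obtain ⟨⟨k', p', i⟩, ⟨h1, h2⟩, rfl⟩ := hx
    dsimp only at h1
    subst h1
    dsimp only at h2
    subst h2
    have h3 : b ⟨k', p', i⟩ = stringVec b k' p' i := by rw [stringVec_of_lt p'.2 i.2]
    rw [h3, halfEnd_stringVec p'.2, hs, hb.e_stringVec, hb.e_stringVec]
  | zero => simp
  | add x y _ _ hx hy => simp only [map_add, hx, hy, smul_add]
  | smul r x _ hx => rw [map_smul, hx, map_smul, map_smul, smul_comm]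

theorem isEqualPiece {l p : ℕ} (hp : 2 * p + 1 < d (2 * l)) :
    IsEqualPiece Φ e h (halfEnd b) (Submodule.span 𝕜
      (b '' {β | pieceLabel d β.1 β.2.1 = (1, 2 * l, p)})) := by
  have hq : d (2 * l) - 1 - p < d (2 * l) := by omega
  refine ⟨l, _, _, hb.isJordanBlock (show p < d (2 * l) by omega), hb.isJordanBlock hq, ?_, ?_,
    hb.isotropic (by omega), hb.isotropic (by omega), fun a ha => ?_, fun a ha => ?_⟩
  · refine b.linearIndependent.disjoint_span_image (Set.disjoint_left.2 fun β h1 h2 => ?_)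
    have h3 := h1.2
    have h4 := h2.2
    omega
  · rw [← Submodule.span_union, ← Set.image_union]
    congr 2
    ext ⟨k, q, i⟩
    have hqk := q.2
    simp only [Set.mem_union, Set.mem_ofPred_eq, pieceLabel]
    constructor
    · rintro (⟨rfl, h2⟩ | ⟨rfl, h2⟩)
      · rw [if_neg (by omega)]
        ext <;> simp only
        omega
      · rw [if_neg (by omega)]
        ext <;> simp only
        omega
    · split_ifs with h1
      · intro h2; simp at h2
      · intro h2
        simp only [Prod.mk.injEq, true_and] at h2
        obtain ⟨rfl, h2⟩ := h2
        omega
  · rw [hb.halfEnd_on_string (s := 1) (fun i => by rw [halfVec, if_pos hp, one_smul]) a ha, one_smul]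
  · rw [hb.halfEnd_on_string (s := -1) (fun i => by
      rw [halfVec, if_neg (by omega), if_pos (by omega), neg_one_smul]) a ha, neg_one_smul]

theorem isTrivialPiece (hodd : ∀ k, Odd k → d k = 0) :
    IsTrivialPiece e h (halfEnd b) (Submodule.span 𝕜
      (b '' {β | pieceLabel d β.1 β.2.1 = (0, 0, 0)})) := by
  intro u hu
  induction hu using Submodule.span_induction with
  | mem x hx =>
    obtain ⟨⟨k, p, i⟩, hβ, rfl⟩ := hx
    simp only [Set.mem_ofPred_eq, pieceLabel] at hβ
    have hp := p.2
    have hi := i.2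
    split_ifs at hβ with h1
    · simp only [Prod.mk.injEq, true_and, and_true] at hβ
      -- The label `(k + 2) / 4 = 0` leaves `k < 2`, and strings with `k = 1` are excluded by
      -- parity.
      have hk : k = 0 := by
        have h2 : k < 2 := by omega
        interval_cases k
        · rfl
        · have := hodd 1 odd_one
          omega
      subst hk
      have h3 : b ⟨0, p, i⟩ = stringVec b 0 p 0 := by
        rw [stringVec_of_lt p.2 one_pos]
        congr
        omega
      rw [h3, hb.e_stringVec, hb.h_stringVec, halfEnd_stringVec p.2, stringVec_of_le (i := 0 + 1) (by omega),
        halfVec, if_neg (by omega), if_neg (by omega), if_pos rfl]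
      simp
    · simp at hβ
  | zero => simp
  | add x y _ _ hx hy => simp [hx.1, hx.2.1, hx.2.2, hy.1, hy.2.1, hy.2.2]
  | smul r x _ hx => simp [hx.1, hx.2.1, hx.2.2]

theorem isMixedPiece {m : ℕ} (hm : 1 ≤ m) (h4 : Odd (d (4 * m))) (h2 : Odd (d (4 * m - 2)))
    (hodd : ∀ k, Odd k → d k = 0) :
    IsMixedPiece Φ e h (halfEnd b) (Submodule.span 𝕜
      (b '' {β | pieceLabel d β.1 β.2.1 = (0, m, 0)})) := by
  obtain ⟨c, hc⟩ := h4
  obtain ⟨c', hc'⟩ := h2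
  have hcd : c < d (4 * m) := by omega
  have hcd' : c' < d (4 * m - 2) := by omega
  -- The offsets `i - 1` and `i - 2` give `v i` and `w i` the same weight, as the second string
  -- starts two higher.
  refine ⟨m, fun i => stringVec b (4 * m) c (i - 1), fun i => stringVec b (4 * m - 2) c' (i - 2), hm,
    ?_, ?_, fun i hi => stringVec_of_le (by omega), fun i hi => stringVec_of_le (by omega),
    ?_, ?_, ?_, ?_, ?_, ?_, ?_, ?_, ?_⟩
  · have heq : (Sum.elim (fun i : Set.Icc 1 (4 * m + 1) => stringVec b (4 * m) c ((i : ℕ) - 1))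
        (fun i : Set.Icc 2 (4 * m) => stringVec b (4 * m - 2) c' ((i : ℕ) - 2))) =
        b ∘ Sum.elim
          (fun i : Set.Icc 1 (4 * m + 1) => ⟨4 * m, ⟨c, hcd⟩, ⟨(i : ℕ) - 1, by have := i.2.2; omega⟩⟩)
          (fun i : Set.Icc 2 (4 * m) =>
            ⟨4 * m - 2, ⟨c', hcd'⟩, ⟨(i : ℕ) - 2, by have := i.2.2; omega⟩⟩) := by
      funext i
      rcases i with i | i
      · exact stringVec_of_lt hcd _
      · exact stringVec_of_lt hcd' _
    rw [heq]
    refine b.linearIndependent.comp _ ?_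
    rintro (⟨i, hi1, hi2⟩ | ⟨i, hi1, hi2⟩) (⟨j, hj1, hj2⟩ | ⟨j, hj1, hj2⟩) hij
    · simp at hij
      exact congrArg Sum.inl (Subtype.ext (show i = j by omega))
    · simp at hij
      omega
    · simp at hij
      omega
    · simp at hij
      exact congrArg Sum.inr (Subtype.ext (show i = j by omega))
  · congr 1
    ext z
    constructor
    · rintro (⟨i, ⟨hi1, hi2⟩, rfl⟩ | ⟨i, ⟨hi1, hi2⟩, rfl⟩)
      · refine ⟨⟨4 * m, ⟨c, hcd⟩, ⟨i - 1, by omega⟩⟩, ?_, (stringVec_of_lt hcd _).symm⟩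
        simp only [Set.mem_ofPred_eq, pieceLabel]
        rw [if_pos (by omega)]
        congr 2
        omega
      · refine ⟨⟨4 * m - 2, ⟨c', hcd'⟩, ⟨i - 2, by omega⟩⟩, ?_, (stringVec_of_lt hcd' _).symm⟩
        simp only [Set.mem_ofPred_eq, pieceLabel]
        rw [if_pos (by omega)]
        congr 2
        omega
    · rintro ⟨⟨k, p, i⟩, hβ, rfl⟩
      simp only [Set.mem_ofPred_eq, pieceLabel] at hβ
      have hp := p.2
      have hi := i.2
      split_ifs at hβ with h1
      · simp only [Prod.mk.injEq, true_and, and_true] at hβ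
        have hk : k = 4 * m ∨ k = 4 * m - 2 := by
          have hk2 : ¬ Odd k := fun h => by have := hodd k h; omega
          rw [Nat.not_odd_iff] at hk2
          omega
        rcases hk with rfl | rfl
        · left
          refine ⟨i + 1, ⟨by omega, by omega⟩, ?_⟩
          simp only
          rw [stringVec_of_lt hcd (by omega)]
          congr
          omega
        · right
          refine ⟨i + 2, ⟨by omega, by omega⟩, ?_⟩
          simp only
          rw [stringVec_of_lt hcd' (by omega)]
          congr
          omega
      · simp at hβ
  · intro i hi
    simp only
    rw [hb.e_stringVec, show i - 1 + 1 = i + 1 - 1 by omega]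
  · intro i hi
    simp only
    rw [hb.e_stringVec, show i - 2 + 1 = i + 1 - 2 by omega]
  · simp only
    rw [hb.h_stringVec]
    congr 1
    push_cast; ring
  · simp only
    rw [hb.h_stringVec]
    congr 1
    push_cast [show 2 ≤ 4 * m by omega]; ring
  · rintro i ⟨hi1, hi2⟩ j ⟨hj1, hj2⟩
    simp only
    rw [hb.form_stringVec _ _ hcd hcd, if_pos le_rfl, mul_one]
    obtain ⟨i, rfl⟩ := Nat.exists_eq_add_of_le hi1
    refine if_congr (by omega) ?_ rfl
    rw [show 1 + i - 1 = i by omega, show 1 + i + 1 = i + 2 by omega, pow_add]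
    simp
  · rintro i ⟨hi1, hi2⟩ j ⟨hj1, hj2⟩
    simp only
    rw [hb.form_stringVec _ _ hcd' hcd', if_pos le_rfl, mul_one]
    obtain ⟨i, rfl⟩ := Nat.exists_eq_add_of_le hi1
    refine if_congr (by omega) ?_ rfl
    rw [show 2 + i - 2 = i by omega, pow_add]
    simp
  · rintro i ⟨hi1, hi2⟩ j ⟨hj1, hj2⟩
    simp only
    rw [hb.form_stringVec _ _ hcd hcd', if_neg (by omega)]
  · intro i hi
    simp only
    rw [halfEnd_stringVec hcd, halfVec, if_neg (by omega), if_neg (by omega), if_neg (by omega),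
      if_pos (by omega), show d (4 * m - 2) / 2 = c' by omega, show i - 1 + 1 = i + 2 - 2 by omega]
  · intro i hi
    simp only
    rw [halfEnd_stringVec hcd', halfVec, if_neg (by omega), if_neg (by omega), if_neg (by omega),
      if_neg (by omega), show 4 * m - 2 + 2 = 4 * m by omega, show d (4 * m) / 2 = c by omega,
      show i - 2 + 3 = i + 2 - 1 by omega]

/-- Paired strings carry the same label, so the label classes are orthogonal. The existence of an
odd multiplicity is recorded with the last two types so that the symplectic case can exclude them.
-/
theorem isOrthogonalSum [FiniteDimensional 𝕜 V] (hodd : ∀ k, Odd k → d k = 0)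
    (hpar : ∀ m, 1 ≤ m → (Odd (d (4 * m)) ↔ Odd (d (4 * m - 2)))) :
    IsOrthogonalSum Φ fun U => IsEqualPiece Φ e h (halfEnd b) U ∨
      (∃ k, Odd (d k)) ∧ (IsMixedPiece Φ e h (halfEnd b) U ∨ IsTrivialPiece e h (halfEnd b) U) := by
  have := Module.Finite.finite_basis b
  refine isOrthogonalSum_of_partition b (fun β => pieceLabel d β.1 β.2.1) ?_ ?_
  · rintro ⟨k, p, i⟩ ⟨l, q, j⟩ hne
    rw [hb.form, if_neg]
    rintro ⟨rfl, hpq, -⟩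
    apply hne
    simp only [pieceLabel]
    by_cases hpd : 2 * (p : ℕ) + 1 = d k
    · rw [if_pos hpd, if_pos (by omega)]
    · rw [if_neg hpd, if_neg (by omega)]
      congr 2
      omega
  · rintro ⟨k, p, i⟩
    have hp := p.2
    have hk : Even k := by
      rw [← Nat.not_odd_iff_even]
      intro h
      have := hodd k h
      omega
    by_cases hpd : 2 * (p : ℕ) + 1 = d k
    · have hkd : Odd (d k) := ⟨p, hpd.symm⟩
      have hlab : pieceLabel d k p = (0, (k + 2) / 4, 0) := if_pos hpd
      refine Or.inr ⟨⟨k, hkd⟩, ?_⟩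
      simp only [hlab]
      by_cases hm : 1 ≤ (k + 2) / 4
      · left
        rw [Nat.even_iff] at hk
        obtain hk4 | hk4 : k = 4 * ((k + 2) / 4) ∨ k = 4 * ((k + 2) / 4) - 2 := by omega
        · have h1 : Odd (d (4 * ((k + 2) / 4))) := by rwa [← hk4]
          exact hb.isMixedPiece hm h1 ((hpar _ hm).1 h1) hodd
        · have h1 : Odd (d (4 * ((k + 2) / 4) - 2)) := by rwa [← hk4]
          exact hb.isMixedPiece hm ((hpar _ hm).2 h1) h1 hodd
      · right
        rw [show (k + 2) / 4 = 0 by omega]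
        exact hb.isTrivialPiece hodd
    · left
      obtain ⟨l, rfl⟩ := even_iff_two_dvd.1 hk
      have hlab : pieceLabel d (2 * l) p = (1, 2 * l, min (p : ℕ) (d (2 * l) - 1 - p)) := if_neg hpd
      simp only [hlab]
      exact hb.isEqualPiece (by omega)

end IsFormBasis

end

end Existence

/-! ### Parity of string numbers and existence of the construction -/

section Classical

variable {𝕜 : Type u} [Field 𝕜] [CharZero 𝕜] [IsAlgClosed 𝕜] {V : Type v} [AddCommGroup V]
  [Module 𝕜 V] [FiniteDimensional 𝕜 V]

theorem finrank_prim_odd {e h : Module.End 𝕜 V} (hs : ⨆ k : ℤ, wt ((2⁻¹ : 𝕜) • h) k = ⊤) {k : ℕ}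
    (hk : Odd k) : Module.finrank 𝕜 (prim e h k) = 0 := by
  rw [Submodule.finrank_eq_zero, eq_bot_iff]
  refine inf_le_left.trans (le_of_eq (wt_eq_bot_of_odd hs ?_))
  simpa using hk

theorem IsLefschetz.exists_isFormBasis {Φ : LinearMap.BilinForm 𝕜 V} {e h : Module.End 𝕜 V}
    (L : IsLefschetz e h) {ε : 𝕜} (hε : ε = 1 ∨ ε = -1) (hΦ : ∀ a b, Φ a b = ε * Φ b a)
    (hnd : Φ.Nondegenerate) (he : IsSkew Φ e) (hh : IsSkew Φ h) :
    ∃ b : Module.Basis (Σ k, Fin (Module.finrank 𝕜 (prim e h k)) × Fin (k + 1)) 𝕜 V,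
      IsFormBasis Φ e h b fun k => (-1) ^ k * ε := by
  obtain ⟨b, h1, h2, h3⟩ := L.exists_form_basis hε hΦ he hh hnd.1 _ (fun _ => rfl)
  exact ⟨b, h1, h2, h3⟩

/-- Only even `k` occur, and for these the form on primitive vectors is alternating. So all
multiplicities are even and no string is left unpaired. -/
theorem exists_spConstruction {Φ : LinearMap.BilinForm 𝕜 V} (hΦ : Φ.IsAlt) (hnd : Φ.Nondegenerate)
    {e h : Module.End 𝕜 V} (L : IsLefschetz e h) (he : IsSkew Φ e) (hh : IsSkew Φ h)
    (hs : ⨆ k : ℤ, wt ((2⁻¹ : 𝕜) • h) k = ⊤) : ∃ x, SpConstruction Φ e h x := by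
  have hΦ' : ∀ a b, Φ a b = -1 * Φ b a := fun a b => by
    linear_combination -(LinearMap.IsAlt.neg hΦ a b)
  obtain ⟨b, hb⟩ := L.exists_isFormBasis (Or.inr rfl) hΦ' hnd he hh
  have heven : ∀ k, ¬ Odd (Module.finrank 𝕜 (prim e h k)) := by
    intro k
    rw [Nat.not_odd_iff_even]
    rcases Nat.even_or_odd k with hk | hk
    · exact L.even_finrank_prim hΦ' he hh hnd.1 k (by rw [hk.neg_one_pow]; ring)
    · rw [finrank_prim_odd hs hk]; exact Even.zero
  obtain ⟨n, U, hU, hO, hP⟩ := hb.isOrthogonalSum (fun k hk => finrank_prim_odd hs hk)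
    (fun m _ => iff_of_false (heven _) (heven _))
  exact ⟨halfEnd b, n, U, hU, hO, fun j => (hP j).resolve_right fun h => heven _ h.1.choose_spec⟩

/-- The weight dimensions of `h` and `h / 2` show that `z` has as many strings of degree `2m - 1` as
`e` has of degrees `4m` and `4m - 2` together. For odd degree the form on primitive vectors of `z`
is alternating, so this sum is even. -/
theorem exists_soConstruction {Φ : LinearMap.BilinForm 𝕜 V} (hΦ : Φ.IsSymm) (hnd : Φ.Nondegenerate)
    {e h z : Module.End 𝕜 V} (L : IsLefschetz e h) (he : IsSkew Φ e) (hh : IsSkew Φ h)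
    (hz : IsSkew Φ z) (L' : IsLefschetz z ((2⁻¹ : 𝕜) • h)) : ∃ x, SoConstruction Φ e h x := by
  have hΦ' : ∀ a b, Φ a b = 1 * Φ b a := fun a b => by rw [one_mul]; exact hΦ.eq a b
  obtain ⟨b, hb⟩ := L.exists_isFormBasis (Or.inl rfl) hΦ' hnd he hh
  have hh' : IsSkew Φ ((2⁻¹ : 𝕜) • h) := fun a b => by simp [hh a b]
  have hpar : ∀ m, 1 ≤ m → (Odd (Module.finrank 𝕜 (prim e h (4 * m))) ↔
      Odd (Module.finrank 𝕜 (prim e h (4 * m - 2)))) := by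
    intro m hm
    have h1 := L'.even_finrank_prim hΦ' hz hh' hnd.1 (2 * m - 1) (by
      rw [(show Odd (2 * m - 1) from ⟨m - 1, by omega⟩).neg_one_pow]; ring)
    have h2 := L'.finrank_prim (2 * m - 1)
    have h3 := L.finrank_prim (4 * m)
    have h4 := L.finrank_prim (4 * m - 2)
    rw [wt_half, wt_half, show (2 : ℤ) * -((2 * m - 1 + 2 : ℕ) : ℤ) = -((4 * m + 2 : ℕ) : ℤ) by omega,
      show (2 : ℤ) * -((2 * m - 1 : ℕ) : ℤ) = -((4 * m - 2 : ℕ) : ℤ) by omega] at h2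
    rw [show 4 * m - 2 + 2 = 4 * m by omega] at h4
    rw [Nat.odd_iff, Nat.odd_iff]
    rw [Nat.even_iff] at h1
    omega
  obtain ⟨n, U, hU, hO, hP⟩ := hb.isOrthogonalSum (fun k hk => finrank_prim_odd L'.span hk) hpar
  exact ⟨halfEnd b, n, U, hU, hO, fun j => (hP j).imp_right And.right⟩

end Classical

/-! ### Assembling the three cases -/

section Conclusion

variable {𝕜 : Type u} [Field 𝕜] [CharZero 𝕜] {V : Type v} [AddCommGroup V] [Module 𝕜 V]
  [FiniteDimensional 𝕜 V] {g : LieSubalgebra 𝕜 (Module.End 𝕜 V)} {G : Subgroup (V ≃ₗ[𝕜] V)}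

/-- A construction that applies to every triple and yields Lefschetz pairs with `h / 2` commuting
with `e` shows that friendly pairs are very friendly. -/
theorem HasConj.isVeryFriendlyPair (hG : HasConj g G) {ι : Type w} {H : LieSubalgebra 𝕜 g}
    {Δ : Module.Basis ι 𝕜 (Module.Dual 𝕜 H)} {O O' : Set g} (hF : IsFriendlyPair G Δ O O')
    {C : g → g → g → Prop}
    (hC : ∀ e h f : g, IsTriple e h f → (∃ z y : g, IsTriple z ((2⁻¹ : 𝕜) • h) y) →
      (∃ x, C e h x) ∧ ∀ x, C e h x →
        IsLefschetz (x : Module.End 𝕜 V) ((2⁻¹ : 𝕜) • (h : Module.End 𝕜 V)) ∧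
          ∀ v, (e : Module.End 𝕜 V) ((x : Module.End 𝕜 V) v) =
            (x : Module.End 𝕜 V) ((e : Module.End 𝕜 V) v)) :
    IsVeryFriendlyPair G Δ O O' ∧ ∀ e ∈ O, ∀ h f : g, IsTriple e h f →
      (∃ x, C e h x) ∧ ∀ x, C e h x → IsHalfElement h O' x ∧ ⁅e, x⁆ = 0 := by
  have key : ∀ e ∈ O, ∀ h f : g, IsTriple e h f →
      (∃ x, C e h x) ∧ ∀ x, C e h x → IsHalfElement h O' x ∧ ⁅e, x⁆ = 0 := by
    intro e he h f t
    have hO' := hG.exists_half hF he t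
    have hz : ∃ z y : g, IsTriple z ((2⁻¹ : 𝕜) • h) y := by
      obtain ⟨z, y, -, hzy⟩ := hO'
      exact ⟨z, y, hzy⟩
    obtain ⟨hex, hall⟩ := hC e h f t hz
    refine ⟨hex, fun x hx => ⟨hG.isHalfElement t (hall x hx).1 hO', Subtype.ext ?_⟩⟩
    exact LinearMap.ext fun v => sub_eq_zero.2 ((hall x hx).2 v)
  refine ⟨⟨hF, fun e he h f t => ?_⟩, key⟩
  obtain ⟨⟨x, hx⟩, hall⟩ := key e he h f t
  exact ⟨x, hall x hx⟩

end Conclusion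

end FriendlyPairs

open FriendlyPairs in
theorem lemma5p1 {𝕜 : Type*} [Field 𝕜] [IsAlgClosed 𝕜] [CharZero 𝕜]
    {V : Type*} [AddCommGroup V] [Module 𝕜 V] [FiniteDimensional 𝕜 V] {ι : Type*} :
    -- the special linear case
    (∀ H : LieSubalgebra 𝕜 (slLie 𝕜 V), H.IsCartanSubalgebra →
      ∀ Δ : Module.Basis ι 𝕜 (Module.Dual 𝕜 H), IsSimpleRoots H Δ →
      ∀ O O' : Set (slLie 𝕜 V), IsFriendlyPair (slGroup 𝕜 V) Δ O O' →
        IsVeryFriendlyPair (slGroup 𝕜 V) Δ O O' ∧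
        ∀ e ∈ O, ∀ h f : slLie 𝕜 V, IsTriple e h f →
          (∃ x : slLie 𝕜 V, SlConstruction (e : Module.End 𝕜 V) x) ∧
          ∀ x : slLie 𝕜 V, SlConstruction (e : Module.End 𝕜 V) x →
            IsHalfElement h O' x ∧ ⁅e, x⁆ = 0) ∧
    -- the orthogonal case
    (∀ Φ : LinearMap.BilinForm 𝕜 V, Φ.IsSymm → Φ.Nondegenerate →
      ∀ H : LieSubalgebra 𝕜 (skewAdjointLieSubalgebra Φ), H.IsCartanSubalgebra →
      ∀ Δ : Module.Basis ι 𝕜 (Module.Dual 𝕜 H), IsSimpleRoots H Δ →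
      ∀ O O' : Set (skewAdjointLieSubalgebra Φ),
        IsFriendlyPair (isometryGroup Φ ⊓ slGroup 𝕜 V) Δ O O' →
        IsVeryFriendlyPair (isometryGroup Φ ⊓ slGroup 𝕜 V) Δ O O' ∧
        ∀ e ∈ O, ∀ h f : skewAdjointLieSubalgebra Φ, IsTriple e h f →
          (∃ x : skewAdjointLieSubalgebra Φ, SoConstruction Φ (e : Module.End 𝕜 V) h x) ∧
          ∀ x : skewAdjointLieSubalgebra Φ, SoConstruction Φ (e : Module.End 𝕜 V) h x →
            IsHalfElement h O' x ∧ ⁅e, x⁆ = 0) ∧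
    -- the symplectic case
    (∀ Φ : LinearMap.BilinForm 𝕜 V, Φ.IsAlt → Φ.Nondegenerate →
      ∀ H : LieSubalgebra 𝕜 (skewAdjointLieSubalgebra Φ), H.IsCartanSubalgebra →
      ∀ Δ : Module.Basis ι 𝕜 (Module.Dual 𝕜 H), IsSimpleRoots H Δ →
      ∀ O O' : Set (skewAdjointLieSubalgebra Φ), IsFriendlyPair (isometryGroup Φ) Δ O O' →
        IsVeryFriendlyPair (isometryGroup Φ) Δ O O' ∧
        ∀ e ∈ O, ∀ h f : skewAdjointLieSubalgebra Φ, IsTriple e h f →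
          (∃ x : skewAdjointLieSubalgebra Φ, SpConstruction Φ (e : Module.End 𝕜 V) h x) ∧
          ∀ x : skewAdjointLieSubalgebra Φ, SpConstruction Φ (e : Module.End 𝕜 V) h x →
            IsHalfElement h O' x ∧ ⁅e, x⁆ = 0) := by
  
  refine ⟨fun H _ Δ _ O O' hF => ?_, fun Φ hΦ hnd H _ Δ _ O O' hF => ?_,
    fun Φ hΦ hnd H _ Δ _ O O' hF => ?_⟩
  · refine hasConj_sl.isVeryFriendlyPair hF
      (C := fun e _ x => SlConstruction (e : Module.End 𝕜 V) x) fun e h f t ⟨z, y, hzy⟩ => ?_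
    have hL : IsLefschetz ((e : Module.End 𝕜 V) ^ 2) ((2⁻¹ : 𝕜) • (h : Module.End 𝕜 V)) :=
      t.coe.isLefschetz.sq hzy.coe.isLefschetz.span
    refine ⟨⟨⟨(e : Module.End 𝕜 V) ^ 2, ?_⟩, rfl⟩, fun x hx => ?_⟩
    · rw [mem_slLie]
      -- The trace of `e ^ 2` vanishes because it raises the weights of `h / 2` and is therefore
      -- nilpotent.
      obtain ⟨n, hn⟩ := isNilpotent_of_raising hL.comm
      exact (LinearMap.isNilpotent_trace_of_isNilpotent ⟨n, hn⟩).eq_zero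
    · have hx' : (x : Module.End 𝕜 V) = (e : Module.End 𝕜 V) ^ 2 := hx
      rw [hx']
      exact ⟨hL, fun v => rfl⟩
  · refine (hasConj_so hΦ hnd).isVeryFriendlyPair hF
      (C := fun e h x => SoConstruction Φ (e : Module.End 𝕜 V) h x) fun e h f t ⟨z, y, hzy⟩ => ?_
    have L := t.coe.isLefschetz
    have he := mem_skewAdjoint_iff.1 e.2
    obtain ⟨x, hx⟩ := exists_soConstruction hΦ hnd L he (mem_skewAdjoint_iff.1 h.2)
      (mem_skewAdjoint_iff.1 z.2) hzy.coe.isLefschetz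
    exact ⟨⟨⟨x, mem_skewAdjoint_iff.2 (hx.isSkew hΦ.eq he)⟩, hx⟩,
      fun x hx => ⟨hx.isLefschetz L, hx.commute L⟩⟩
  · refine (hasConj_sp hΦ hnd).isVeryFriendlyPair hF
      (C := fun e h x => SpConstruction Φ (e : Module.End 𝕜 V) h x) fun e h f t ⟨z, y, hzy⟩ => ?_
    have L := t.coe.isLefschetz
    have he := mem_skewAdjoint_iff.1 e.2
    obtain ⟨x, hx⟩ := exists_spConstruction hΦ hnd L he (mem_skewAdjoint_iff.1 h.2)
      hzy.coe.isLefschetz.span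
    exact ⟨⟨⟨x, mem_skewAdjoint_iff.2 (hx.isSkew he)⟩, hx⟩,
      fun x hx => ⟨hx.soConstruction.isLefschetz L, hx.soConstruction.commute L⟩⟩
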